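/- Fix $d\ge 0$. There is a real polynomial $p_d$, depending only on $d$, such that the following holds. Let $f,a_1,\dots,a_d$ be positive integers with $\gcd(f,a_1,\dots,a_d)=1$, let $H\in\mathbb Z^{(d+1)\times d}$ be the matrix whose first row is $(-a_1,\dots,-a_d)$ and whose remaining rows form $f$ times the identity matrix, and let $C(H)$ be the cone of nonnegative real combinations of its columns. Let $\mathcal U$ be the set of unimodular matrices $U\in\mathbb Z^{(d+1)\times(d+1)}$ with nonnegative $(1,1)$-entry such that $UH=\binom{\mathbf 0^T}{H'}$ for some $H'\in\mathbb Z^{d\times d}$. Then $\mathcal U\ne\emptyset$, each $U\in\mathcal U$ has first row $(f,a_1,\dots,a_d)$, and there are a finite index set $I$, signs $\epsilon_i\in\{1,-1\}$ and vectors $\alpha_{i1},\dots,\alpha_{id}\in\mathbb Z^{d+1}$ $(i\in I)$ such that: (1) For each $i\in I$ the vectors $\alpha_{i1},\dots,\alpha_{id}$ generate a unimodular cone, i.e. they are linearly independent and form a $\mathbb Z$-basis of the lattice of integer points in their real span. (2) The sum below is short: $|I|\le p_d(\log \mathrm{ind}\,C(H'))$ for each $U\in\mathcal U$, where $\mathrm{ind}\,C(H')$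 is $|\det|$ of the matrix obtained from $H'$ by dividing each column by the gcd of its entries. (3) For every integer $b$, with $v=(b/f,0,\dots,0)^T\in\mathbb Q^{d+1}$, the constant term $$\mathrm{CT}=\operatorname*{CT}_\lambda \frac{1}{\underline{1-\lambda^f y_0}}\,\frac{\lambda^{-b}}{\prod_{j=1}^d(1-\lambda^{a_j}y_j)}$$ is well defined and is the generating function $\sigma_{v+C(H)}(\boldsymbol y)=\sum_{\alpha\in (v+C(H))\cap\mathbb Z^{d+1}}\boldsymbol y^\alpha$ of the vertex cone $v+C(H)$. For every choice of $\gamma_i\in\mathbb Z^{d+1}$ and $k_{ij}\in\mathbb Q$ with $v=\gamma_i+\sum_{j=1}^d k_{ij}\alpha_{ij}$ $(i\in I)$, putting $\alpha_{i0}=\gamma_i+\sum_{j=1}^d\lceil k_{ij}\rceil\alpha_{ij}$, one has $$\mathrm{CT}=\sum_{i\in I}\epsilon_i\frac{\boldsymbol y^{\alpha_{i0}}}{\prod_{j=1}^d(1-\boldsymbol y^{\alpha_{ij}})},$$ and the $i$-th fraction is the generating function of $v+C(\alpha_{i1}\mid\dots\mid\alpha_{id})$. For every $U\in\mathcal U$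 and all $i$ one may take $\gamma_i=U^{-1}(b,0,\dots,0)^T$; that is, suitable $k_{ij}$ then exist. Here the constant term of a rational function $E(\lambda)$ over $\mathbb C(y_0,\dots,y_d)$ with denominator factors $1-u_i\lambda^{w_i}$ (and possibly a power of $\lambda$), the factor $1-u_{i_0}\lambda^{w_{i_0}}$ being underlined, is $A_{i_0}(0)$ in the partial fraction decomposition $E=P(\lambda)+p(\lambda)/\lambda^m+\sum_i A_i(\lambda)/(1-u_i\lambda^{w_i})$ with polynomials $P,p,A_i$, $\deg p<m$, $\deg A_i<w_i$. A rational function $R$ is the generating function of a set $S$ if $R=p/q$ for Laurent polynomials $p$ and $q\neq0$ such that $q\cdot\sum_{\alpha\in S\cap\mathbb Z^{d+1}}\boldsymbol y^\alpha=p$ as formal sums. -/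

import Mathlib

open scoped BigOperators

noncomputable section

/-- The field `ℂ(y_0, …, y_{n-1})` of rational functions in `n` variables. -/
abbrev YField (n : ℕ) : Type := FractionRing (MvPolynomial (Fin n) ℂ)

/-- The variable `y_i` as a rational function. -/
def yVar {n : ℕ} (i : Fin n) : YField n :=
  algebraMap (MvPolynomial (Fin n) ℂ) (YField n) (MvPolynomial.X i)

/-- The Laurent monomial `y^α = ∏ y_i ^ α_i`, for an integer exponent vector `α`. -/
def yMono {n : ℕ} (α : Fin n → ℤ) : YField n := ∏ i, yVar i ^ α i

/-- The rational function `∑ q_m y^m` of a Laurent polynomial, given by its finitely supported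
coefficient function `q`. -/
def laurentToField {n : ℕ} (q : (Fin n → ℤ) →₀ ℂ) : YField n :=
  q.sum fun m c => algebraMap ℂ (YField n) c * yMono m

/-- The coefficients of the formal sum `σ_S(y) = ∑ y^α` over `α ∈ S ∩ ℤ^n`. -/
def latticeIndicator {n : ℕ} (S : Set (Fin n → ℝ)) (x : Fin n → ℤ) : ℂ :=
  S.indicator 1 (fun i => (x i : ℝ))

/-- The rational function `R` is the generating function `σ_S(y)` of the lattice points of `S`:
for some nonzero Laurent polynomial `q` the product of `q` with the formal sum `∑ y^α`
(`α ∈ S ∩ ℤ^n`) is a Laurent polynomial `p`, and `R = p / q`. (There is at most one such `R`,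
because Laurent polynomials form an integral domain acting on formal sums.) -/
def IsLatticeGenFun {n : ℕ} (S : Set (Fin n → ℝ)) (R : YField n) : Prop :=
  ∃ p q : (Fin n → ℤ) →₀ ℂ, q ≠ 0 ∧
    (∀ x : Fin n → ℤ, (q.sum fun m c => c * latticeIndicator S (x - m)) = p x) ∧
    R * laurentToField q = laurentToField p

/-- The vertex cone `v + C(A) = {v + ∑ k_j α_j : k_j ≥ 0 real}`, where `α_j` are the columns
of `A`. -/
def vertexCone {n d : ℕ} (v : Fin n → ℚ) (A : Matrix (Fin n) (Fin d) ℤ) :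
    Set (Fin n → ℝ) :=
  {x | ∃ k : Fin d → ℝ, (∀ j, 0 ≤ k j) ∧ ∀ r, x r = (v r : ℝ) + ∑ j, k j * (A r j : ℝ)}

/-- The columns of `A` generate a unimodular cone: they are linearly independent and form a
`ℤ`-basis of the lattice of all integer points of their real linear span. (For a square matrix
this says `det A = ±1`.) -/
def GeneratesUnimodularCone {n d : ℕ} (A : Matrix (Fin n) (Fin d) ℤ) : Prop :=
  LinearIndependent ℝ (fun (j : Fin d) (r : Fin n) => (A r j : ℝ)) ∧
  ∀ x : Fin n → ℤ,
    (fun r => (x r : ℝ)) ∈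
        Submodule.span ℝ (Set.range fun (j : Fin d) (r : Fin n) => (A r j : ℝ)) →
      x ∈ Submodule.span ℤ (Set.range fun (j : Fin d) (r : Fin n) => A r j)

/-- The matrix obtained by dividing each column by the gcd of its entries. -/
def primitiveColumns {d : ℕ} (A : Matrix (Fin d) (Fin d) ℤ) : Matrix (Fin d) (Fin d) ℤ :=
  Matrix.of fun i j => A i j / Finset.univ.gcd fun i' => A i' j

/-- The index of the simplicial cone `C(A)`, for a nonsingular integer matrix `A`: the absolute
value of the determinant of the matrix of primitive generators. -/
def coneIndex {d : ℕ} (A : Matrix (Fin d) (Fin d) ℤ) : ℕ := (primitiveColumns A).det.natAbs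

/-- The `(d+1) × d` matrix `H` with first row `(-a_1, …, -a_d)` above `f` times the identity. -/
def denumerantMatrix {d : ℕ} (f : ℕ) (a : Fin d → ℕ) : Matrix (Fin (d + 1)) (Fin d) ℤ :=
  Matrix.of fun i j =>
    Fin.cases (motive := fun _ => ℤ) (-(a j : ℤ)) (fun r => if r = j then (f : ℤ) else 0) i

/-- The vertex `v = (b / f, 0, …, 0)`. -/
def denumerantVertex (d f : ℕ) (b : ℤ) : Fin (d + 1) → ℚ :=
  Pi.single 0 ((b : ℚ) / (f : ℚ))

/-- `U` is a unimodular integer matrix with nonnegative `(1,1)`-entry such that the first row of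
`U * H` is zero. -/
def IsFlattening {d : ℕ} (H : Matrix (Fin (d + 1)) (Fin d) ℤ)
    (U : Matrix (Fin (d + 1)) (Fin (d + 1)) ℤ) : Prop :=
  IsUnit U.det ∧ (∀ j, (U * H) 0 j = 0) ∧ 0 ≤ U 0 0

/-- The block `H'` of `U * H` below the first row. -/
def lowerBlock {d : ℕ} (H : Matrix (Fin (d + 1)) (Fin d) ℤ)
    (U : Matrix (Fin (d + 1)) (Fin (d + 1)) ℤ) : Matrix (Fin d) (Fin d) ℤ :=
  Matrix.of fun r j => (U * H) r.succ j

/-- The binomial `1 - u λ^w`, as a rational function in `λ`. -/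
def ctFactor {K : Type} [Field K] (u : K) (w : ℕ) : RatFunc K :=
  1 - RatFunc.C u * RatFunc.X ^ w

/-- `c` is the constant term in `λ` of `E`, contributed by the underlined factor
`1 - u_{i₀} λ^{w_{i₀}}` of its denominator: there is a partial fraction decomposition
`E = P(λ) + p(λ)/λ^m + ∑ A_i(λ)/(1 - u_i λ^{w_i})` with `deg p < m` and `deg A_i < w_i`, and
`c = A_{i₀}(0)`. -/
def IsUnderlinedCT {K : Type} [Field K] {n : ℕ} (E : RatFunc K) (u : Fin n → K) (w : Fin n → ℕ)
    (i₀ : Fin n) (c : K) : Prop :=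
  ∃ (P p : Polynomial K) (m : ℕ) (A : Fin n → Polynomial K),
    p.degree < m ∧ (∀ i, (A i).degree < w i) ∧
    E = algebraMap (Polynomial K) (RatFunc K) P
        + algebraMap (Polynomial K) (RatFunc K) p / RatFunc.X ^ m
        + ∑ i, algebraMap (Polynomial K) (RatFunc K) (A i) / ctFactor (u i) (w i) ∧
    c = (A i₀).eval 0

/-- The rational function
`λ^{-b} / ((1 - λ^f y_0) (1 - λ^{a_1} y_1) ⋯ (1 - λ^{a_d} y_d))` in `λ` over `ℂ(y_0, …, y_d)`. -/
def denumerantFun {d : ℕ} (f : ℕ) (a : Fin d → ℕ) (b : ℤ) : RatFunc (YField (d + 1)) :=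
  RatFunc.X ^ (-b) / (ctFactor (yVar 0) f * ∏ j : Fin d, ctFactor (yVar j.succ) (a j))

/-- `c` is the constant term in `λ` of `denumerantFun f a b` with underlined factor
`1 - λ^f y_0`. -/
def IsDenumerantCT {d : ℕ} (f : ℕ) (a : Fin d → ℕ) (b : ℤ) (c : YField (d + 1)) : Prop :=
  IsUnderlinedCT (denumerantFun f a b) yVar (Fin.cons f a) 0 c

/-- The exponent `α_0 = γ + ∑ ⌈k_j⌉ α_j`, where `α_j` are the columns of `A`. -/
def ceilExponent {n d : ℕ} (γ : Fin n → ℤ) (k : Fin d → ℚ) (A : Matrix (Fin n) (Fin d) ℤ) :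
    Fin n → ℤ :=
  fun r => γ r + ∑ j, ⌈k j⌉ * A r j

/-- The rational function `y^{α_0} / ∏ (1 - y^{α_j})`, where `α_j` are the columns of `A`. -/
def coneTerm {n d : ℕ} (α₀ : Fin n → ℤ) (A : Matrix (Fin n) (Fin d) ℤ) : YField n :=
  yMono α₀ / ∏ j, (1 - yMono fun r => A r j)

end

open scoped BigOperators

noncomputable section

/-! ### Formal sums as a module over Laurent polynomials -/

/-! Two computations of one generating function are compared.

Constant term. The linear functional sending `λ^e` to `y_0^{-e/f}` when `f ∣ e` and to `0` otherwise
kills multiples of `1 - y_0 λ^f` and returns `p(0)` when `deg p < f`, so it isolates `A_0(0)`.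
Multiplying the cleared partial fraction identity by the geometric sums `∑_{r<f} (y_j λ^{a_j})^r`
turns the other factors into `1 - (y_j λ^{a_j})^f`, on which the functional acts as the scalar `1 -
y_0^{-a_j} y_j^f`. The exponents of these binomials are the columns of `H`, and the numerator
enumerates the lattice points of a half-open fundamental parallelepiped of `v + C(H)`. Hence the
constant term is the generating function of the cone (`IsDenumerantCT.eq_denumerantCT`,
`isLatticeGenFun_denumerantCT`).

Decomposition. This is Barvinok's algorithm applied to facet normals. A formal sum invariant under a
nonzero translation has rational function `0`, so indicator functions may be manipulated modulo such
periodic sums. In the coordinates given by `U` the cone is `B(z - v) ≥ 0`, with `|det B| =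
ind^(d-1)`. Minkowski's theorem gives an integer vector `w = ∑ e_i B_i` with `|e_i| ≤ |det
B|^(-1/d)`. The linear relation among `w` and the rows of `B` expresses the cone, modulo periodic
sums, through the at most `d` cones with one row replaced by `w` (`sum_sign_mem`). Each replacement
multiplies `log |det|` by at most `1 - 1/d`, so the number of unimodular cones reached is polynomial
in `log ind` (`exists_hasUnimodularDecomposition`). The normals never depend on the vertex, so one
decomposition serves every `b`.

Lifting back by `U⁻¹` preserves periodicity, and uniqueness of the rational function of a formal sum
turns the congruence into the asserted equality. -/

lemma yVar_ne_zero {n : ℕ} (i : Fin n) : (yVar i : YField n) ≠ 0 := by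
  unfold yVar
  rw [Ne, map_eq_zero_iff _ (IsFractionRing.injective (MvPolynomial (Fin n) ℂ) (YField n))]
  exact MvPolynomial.X_ne_zero i

lemma yMono_zero {n : ℕ} : (yMono 0 : YField n) = 1 := by simp [yMono]

lemma yMono_add {n : ℕ} (α β : Fin n → ℤ) : yMono (α + β) = yMono α * yMono β := by
  simp only [yMono, Pi.add_apply, ← Finset.prod_mul_distrib]
  exact Finset.prod_congr rfl fun i _ => zpow_add₀ (yVar_ne_zero i) _ _

/-- Monomials as a monoid homomorphism. -/
def yMonoHom (n : ℕ) : Multiplicative (Fin n → ℤ) →* YField n where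
  toFun m := yMono m.toAdd
  map_one' := yMono_zero
  map_mul' a b := yMono_add a.toAdd b.toAdd

/-- The rational function of a Laurent polynomial, as an algebra homomorphism. -/
def laurentEval (n : ℕ) : AddMonoidAlgebra ℂ (Fin n → ℤ) →ₐ[ℂ] YField n :=
  AddMonoidAlgebra.lift ℂ _ _ (yMonoHom n)

/-- Translation of formal sums. -/
def shiftHom (n : ℕ) : Multiplicative (Fin n → ℤ) →* Module.End ℂ ((Fin n → ℤ) → ℂ) where
  toFun m := LinearMap.funLeft ℂ ℂ (fun x => x - m.toAdd)
  map_one' := by ext; simp [LinearMap.funLeft_apply]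
  map_mul' a b := by
    apply LinearMap.ext; intro F; funext x
    simp only [Module.End.mul_apply, LinearMap.funLeft_apply, toAdd_mul]
    congr 1; abel

/-- The multiplication action of Laurent polynomials on formal sums. -/
def laurentAction (n : ℕ) :
    AddMonoidAlgebra ℂ (Fin n → ℤ) →ₐ[ℂ] Module.End ℂ ((Fin n → ℤ) → ℂ) :=
  AddMonoidAlgebra.lift ℂ _ _ (shiftHom n)

lemma laurentEval_single {n : ℕ} (m : Fin n → ℤ) (c : ℂ) :
    laurentEval n (AddMonoidAlgebra.single m c) = algebraMap ℂ _ c * yMono m := by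
  simp [laurentEval, AddMonoidAlgebra.lift_single, yMonoHom, Algebra.smul_def]

lemma laurentAction_single {n : ℕ} (m : Fin n → ℤ) (c : ℂ) (F : (Fin n → ℤ) → ℂ)
    (x : Fin n → ℤ) :
    laurentAction n (AddMonoidAlgebra.single m c) F x = c * F (x - m) := by
  simp [laurentAction, AddMonoidAlgebra.lift_single, shiftHom, LinearMap.funLeft_apply]

lemma laurentToField_eq {n : ℕ} (q : (Fin n → ℤ) →₀ ℂ) :
    laurentToField q = laurentEval n (AddMonoidAlgebra.ofCoeff q) := by
  simp [laurentToField, laurentEval, AddMonoidAlgebra.lift_apply, yMonoHom, Algebra.smul_def]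

lemma laurentAction_apply {n : ℕ} (q : AddMonoidAlgebra ℂ (Fin n → ℤ)) (F : (Fin n → ℤ) → ℂ)
    (x : Fin n → ℤ) :
    laurentAction n q F x = q.coeff.sum fun m c => c * F (x - m) := by
  simp [laurentAction, AddMonoidAlgebra.lift_apply, shiftHom, Finsupp.sum,
    LinearMap.sum_apply, Finset.sum_apply, LinearMap.funLeft_apply]

/-- Acting on the coefficients of a Laurent polynomial is multiplication. -/
lemma laurentAction_coeff {n : ℕ} (q p : AddMonoidAlgebra ℂ (Fin n → ℤ)) :
    laurentAction n q p.coeff = (q * p).coeff := by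
  induction q using AddMonoidAlgebra.induction_linear with
  | zero => simp
  | add a b ha hb => simp [map_add, add_mul, ha, hb]
  | single m c =>
    funext x
    rw [laurentAction_single, AddMonoidAlgebra.coeff_single_mul_apply]
    congr 2; abel

/-- The monomial with nonnegative exponents as a polynomial monomial. -/
lemma yMono_natCast {n : ℕ} (s : Fin n →₀ ℕ) :
    (yMono fun i => (s i : ℤ)) =
      algebraMap (MvPolynomial (Fin n) ℂ) (YField n) (MvPolynomial.monomial s 1) := by
  rw [MvPolynomial.monomial_eq]
  simp [yMono, yVar, Finsupp.prod_fintype]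

/-- A large monomial factor clears all negative exponents, which reduces the claim to the embedding
of polynomials in their fraction field. -/
lemma laurentEval_injective (n : ℕ) : Function.Injective (laurentEval n) := by
  rw [injective_iff_map_eq_zero]
  intro q hq
  obtain ⟨M, hM⟩ : ∃ M : ℕ, ∀ m ∈ q.coeff.support, ∀ i, 0 ≤ m i + M := by
    refine ⟨q.coeff.support.sup fun m => Finset.univ.sup fun i => (m i).natAbs,
      fun m hm i => ?_⟩
    have h1 : (m i).natAbs ≤ Finset.univ.sup fun i => (m i).natAbs :=
      Finset.le_sup (f := fun i => (m i).natAbs) (Finset.mem_univ i)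
    have h2 := Finset.le_sup (f := fun m : Fin n → ℤ => Finset.univ.sup fun i => (m i).natAbs) hm
    omega
  set s : (Fin n → ℤ) → (Fin n →₀ ℕ) :=
    fun m => Finsupp.equivFunOnFinite.symm fun i => (m i + M).toNat with hs
  have hsm : ∀ m ∈ q.coeff.support, (fun i => (s m i : ℤ)) = m + fun _ => (M : ℤ) := by
    intro m hm
    funext i
    simp [hs, hM m hm i]
  have key : algebraMap (MvPolynomial (Fin n) ℂ) (YField n)
      (∑ m ∈ q.coeff.support, MvPolynomial.monomial (s m) (q.coeff m)) =
      laurentEval n q * yMono fun _ => (M : ℤ) := by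
    rw [map_sum, laurentEval, AddMonoidAlgebra.lift_apply, Finsupp.sum, Finset.sum_mul]
    refine Finset.sum_congr rfl fun m hm => ?_
    have : MvPolynomial.monomial (s m) (q.coeff m) =
        MvPolynomial.C (q.coeff m) * MvPolynomial.monomial (s m) 1 := by
      rw [MvPolynomial.C_mul_monomial, mul_one]
    rw [this, map_mul, ← yMono_natCast, hsm m hm, yMono_add, Algebra.smul_def, mul_assoc]
    rfl
  rw [hq, zero_mul, map_eq_zero_iff _
    (IsFractionRing.injective (MvPolynomial (Fin n) ℂ) (YField n))] at key
  by_contra hne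
  obtain ⟨m₀, hm₀⟩ : ∃ m, q.coeff m ≠ 0 := by
    by_contra! h
    exact hne (AddMonoidAlgebra.ext (Finsupp.ext h))
  have h0 := congrArg (MvPolynomial.coeff (s m₀)) key
  rw [MvPolynomial.coeff_sum, Finset.sum_eq_single m₀] at h0
  · simp at h0; exact hm₀ h0
  · intro m hm hmne
    rw [MvPolynomial.coeff_monomial, if_neg]
    intro h
    apply hmne
    have := hsm m hm
    rw [h, hsm m₀ (by simpa using hm₀)] at this
    exact (add_right_cancel this).symm
  · intro h; simp at h; exact absurd h hm₀

lemma laurentEval_ne_zero {n : ℕ} {q : AddMonoidAlgebra ℂ (Fin n → ℤ)} (hq : q ≠ 0) :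
    laurentEval n q ≠ 0 := by
  rwa [Ne, map_eq_zero_iff _ (laurentEval_injective n)]

lemma laurent_mul_ne_zero {n : ℕ} {p q : AddMonoidAlgebra ℂ (Fin n → ℤ)} (hp : p ≠ 0)
    (hq : q ≠ 0) : p * q ≠ 0 := by
  intro h
  have := congrArg (laurentEval n) h
  rw [map_mul, map_zero] at this
  exact mul_ne_zero (laurentEval_ne_zero hp) (laurentEval_ne_zero hq) this

lemma yMono_injective {n : ℕ} {α β : Fin n → ℤ} (h : (yMono α : YField n) = yMono β) :
    α = β := by
  have : laurentEval n (AddMonoidAlgebra.single α 1) =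
      laurentEval n (AddMonoidAlgebra.single β 1) := by
    simp [laurentEval_single, h]
  exact AddMonoidAlgebra.single_left_injective one_ne_zero (laurentEval_injective n this)

/-- `R` is the rational function of the formal sum with coefficients `F`. -/
def IsFormalGenFun {n : ℕ} (F : (Fin n → ℤ) → ℂ) (R : YField n) : Prop :=
  ∃ p q : AddMonoidAlgebra ℂ (Fin n → ℤ), q ≠ 0 ∧
    laurentAction n q F = p.coeff ∧ R * laurentEval n q = laurentEval n p

lemma isLatticeGenFun_iff {n : ℕ} {S : Set (Fin n → ℝ)} {R : YField n} :
    IsLatticeGenFun S R ↔ IsFormalGenFun (latticeIndicator S) R := by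
  constructor
  · rintro ⟨p, q, hq, h1, h2⟩
    refine ⟨.ofCoeff p, .ofCoeff q, ?_, ?_, ?_⟩
    · intro h; exact hq (congrArg AddMonoidAlgebra.coeff h)
    · funext x; rw [laurentAction_apply]; exact h1 x
    · rw [← laurentToField_eq, ← laurentToField_eq, h2]
  · rintro ⟨p, q, hq, h1, h2⟩
    refine ⟨p.coeff, q.coeff, ?_, ?_, ?_⟩
    · intro h; exact hq (AddMonoidAlgebra.ext (by simp [h]))
    · intro x; rw [← h1, laurentAction_apply]
    · rw [laurentToField_eq, laurentToField_eq]; exact h2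

namespace IsFormalGenFun

variable {n : ℕ} {F G : (Fin n → ℤ) → ℂ} {R S : YField n}

/-- Acting on `F` by `q * q'` in either order gives `q' * p = q * p'`. Cross-multiplication in the
field then forces `R = S`, the denominators being nonzero there. -/
lemma unique (h : IsFormalGenFun F R) (h' : IsFormalGenFun F S) : R = S := by
  obtain ⟨p, q, hq, h1, h2⟩ := h
  obtain ⟨p', q', hq', h1', h2'⟩ := h'
  have e : q' * p = q * p' := by
    apply AddMonoidAlgebra.coeff_injective
    apply DFunLike.coe_injective
    rw [← laurentAction_coeff, ← laurentAction_coeff, ← h1, ← h1', ← Module.End.mul_apply,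
      ← Module.End.mul_apply, ← map_mul, ← map_mul, mul_comm]
  have e' := congrArg (laurentEval n) e
  rw [map_mul, map_mul, ← h2, ← h2'] at e'
  have n1 := laurentEval_ne_zero hq
  have n2 := laurentEval_ne_zero hq'
  apply mul_right_cancel₀ (mul_ne_zero n1 n2)
  linear_combination e'

lemma add (h : IsFormalGenFun F R) (h' : IsFormalGenFun G S) :
    IsFormalGenFun (F + G) (R + S) := by
  obtain ⟨p, q, hq, h1, h2⟩ := h
  obtain ⟨p', q', hq', h1', h2'⟩ := h'
  refine ⟨q' * p + q * p', q * q', laurent_mul_ne_zero hq hq', ?_, ?_⟩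
  · rw [map_add, AddMonoidAlgebra.coeff_add, Finsupp.coe_add, ← laurentAction_coeff,
      ← laurentAction_coeff, ← h1, ← h1', ← Module.End.mul_apply,
      ← Module.End.mul_apply, ← map_mul, ← map_mul, mul_comm q' q]
  · simp only [map_add, map_mul, ← h2, ← h2']; ring

lemma smul (h : IsFormalGenFun F R) (c : ℂ) :
    IsFormalGenFun (c • F) (algebraMap ℂ _ c * R) := by
  obtain ⟨p, q, hq, h1, h2⟩ := h
  refine ⟨c • p, q, hq, ?_, ?_⟩
  · rw [map_smul, h1]; rfl
  · rw [map_smul, ← h2, Algebra.smul_def]; ring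

lemma zero : IsFormalGenFun (0 : (Fin n → ℤ) → ℂ) 0 :=
  ⟨0, 1, one_ne_zero, by simp, by simp⟩

lemma sum {ι : Type*} (s : Finset ι) {F : ι → (Fin n → ℤ) → ℂ} {R : ι → YField n}
    (h : ∀ i ∈ s, IsFormalGenFun (F i) (R i)) :
    IsFormalGenFun (∑ i ∈ s, F i) (∑ i ∈ s, R i) := by
  classical
  induction s using Finset.induction_on with
  | empty => simpa using zero
  | insert i s hi ih =>
    rw [Finset.sum_insert hi, Finset.sum_insert hi]
    exact (h i (by simp)).add (ih fun j hj => h j (by simp [hj]))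

/-- A formal sum that is invariant under a nonzero translation has rational function zero. -/
lemma of_periodic (m : Fin n → ℤ) (hm : m ≠ 0) (h : ∀ x, F (x - m) = F x) :
    IsFormalGenFun F 0 := by
  refine ⟨0, 1 - AddMonoidAlgebra.single m 1, ?_, ?_, by simp⟩
  · rw [sub_ne_zero, AddMonoidAlgebra.one_def]
    intro h
    exact hm (AddMonoidAlgebra.single_left_injective one_ne_zero h).symm
  · funext x
    rw [map_sub, map_one, LinearMap.sub_apply, Pi.sub_apply, laurentAction_single, h]
    simp

end IsFormalGenFun

/-- The span of the formal sums that are invariant under some nonzero translation. -/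
def periodicSpan (n : ℕ) : Submodule ℂ ((Fin n → ℤ) → ℂ) :=
  Submodule.span ℂ {F | ∃ m : Fin n → ℤ, m ≠ 0 ∧ ∀ x, F (x - m) = F x}

lemma IsFormalGenFun.of_mem_periodicSpan {n : ℕ} {F : (Fin n → ℤ) → ℂ}
    (hF : F ∈ periodicSpan n) : IsFormalGenFun F 0 := by
  induction hF using Submodule.span_induction with
  | mem F h => obtain ⟨m, hm, h⟩ := h; exact .of_periodic m hm h
  | zero => exact .zero
  | add F G _ _ h1 h2 => simpa using h1.add h2
  | smul c F _ h => simpa using h.smul c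

/-! ### Generating functions of unimodular cones -/

open Classical in
/-- The formal sum over the points `α₀ + ∑ z_j A_j`, where `z_j ∈ ℕ` for `j ∈ s` and `z_j = 0`
for `j ∉ s`. -/
def natConeSum {n d : ℕ} (α₀ : Fin n → ℤ) (A : Matrix (Fin n) (Fin d) ℤ) (s : Finset (Fin d))
    (x : Fin n → ℤ) : ℂ :=
  if ∃ z : Fin d → ℤ, (∀ j ∈ s, 0 ≤ z j) ∧ (∀ j ∉ s, z j = 0) ∧ x = α₀ + A.mulVec z then 1 else 0

/-- Telescoping: subtracting the translate by the `j`-th column cancels every point with `z j ≥ 1`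
and leaves those with `z j = 0`. Injectivity of `A.mulVec` ensures that no point is represented
twice. -/
lemma natConeSum_sub_shift {n d : ℕ} (α₀ : Fin n → ℤ) (A : Matrix (Fin n) (Fin d) ℤ)
    (hA : Function.Injective A.mulVec) {s : Finset (Fin d)} {j : Fin d} (hj : j ∉ s)
    (x : Fin n → ℤ) :
    natConeSum α₀ A (insert j s) x - natConeSum α₀ A (insert j s) (x - A.col j) =
      natConeSum α₀ A s x := by
  classical
  unfold natConeSum
  have e : ∀ z : Fin d → ℤ, A.mulVec (z + Pi.single j 1) = A.mulVec z + A.col j := by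
    intro z; rw [Matrix.mulVec_add, Matrix.mulVec_single_one]
  by_cases h0 : ∃ z : Fin d → ℤ, (∀ i ∈ s, 0 ≤ z i) ∧ (∀ i ∉ s, z i = 0) ∧ x = α₀ + A.mulVec z
  · rw [if_pos h0]
    obtain ⟨z, h1, h2, h3⟩ := h0
    have hpos : ∃ z : Fin d → ℤ, (∀ i ∈ insert j s, 0 ≤ z i) ∧ (∀ i ∉ insert j s, z i = 0) ∧
        x = α₀ + A.mulVec z := by
      refine ⟨z, fun i hi => ?_, fun i hi => h2 i fun h => hi (by simp [h]), h3⟩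
      rcases Finset.mem_insert.1 hi with rfl | hi
      · exact (h2 _ hj).ge
      · exact h1 i hi
    rw [if_pos hpos, if_neg, sub_zero]
    · rintro ⟨z', h1', h2', h3'⟩
      have : A.mulVec z = A.mulVec (z' + Pi.single j 1) := by
        rw [e, ← add_right_inj α₀, ← h3, ← add_assoc, ← h3']; abel
      have hz := congrFun (hA this) j
      rw [h2 j hj] at hz
      have := h1' j (by simp)
      simp at hz
      omega
  · rw [if_neg h0]
    have : (∃ z : Fin d → ℤ, (∀ i ∈ insert j s, 0 ≤ z i) ∧ (∀ i ∉ insert j s, z i = 0) ∧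
        x = α₀ + A.mulVec z) ↔ (∃ z : Fin d → ℤ, (∀ i ∈ insert j s, 0 ≤ z i) ∧
        (∀ i ∉ insert j s, z i = 0) ∧ x - A.col j = α₀ + A.mulVec z) := by
      constructor
      · rintro ⟨z, h1, h2, h3⟩
        refine ⟨z - Pi.single j 1, ?_, ?_, ?_⟩
        · intro i hi
          by_cases hij : i = j
          · subst hij
            have : z i ≠ 0 := by
              intro hzi
              refine h0 ⟨z, fun k hk => h1 k (by simp [hk]), fun k hk => ?_, h3⟩
              by_cases hki : k = i
              · rw [hki, hzi]
              · exact h2 k (by simp [hk, hki])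
            have := h1 i hi
            simp; omega
          · simp [hij]; exact h1 i hi
        · intro i hi
          have : i ≠ j := fun h => hi (by simp [h])
          simp [this, h2 i hi]
        · rw [h3, ← sub_add_cancel z (Pi.single j 1), e]; simp; abel
      · rintro ⟨z, h1, h2, h3⟩
        refine ⟨z + Pi.single j 1, ?_, ?_, ?_⟩
        · intro i hi
          have := h1 i hi
          by_cases hij : i = j
          · subst hij; simp; omega
          · simpa [hij] using this
        · intro i hi
          have : i ≠ j := fun h => hi (by simp [h])
          simp [this, h2 i hi]
        · rw [e, ← add_assoc, ← h3]; abel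
    simp only [this, sub_self]

lemma laurentAction_prod_natConeSum {n d : ℕ} (α₀ : Fin n → ℤ) (A : Matrix (Fin n) (Fin d) ℤ)
    (hA : Function.Injective A.mulVec) (s : Finset (Fin d)) :
    laurentAction n (∏ j ∈ s, (1 - AddMonoidAlgebra.single (A.col j) 1)) (natConeSum α₀ A s) =
      (AddMonoidAlgebra.single α₀ (1 : ℂ)).coeff := by
  classical
  induction s using Finset.induction_on with
  | empty =>
    funext x
    simp only [Finset.prod_empty, map_one, Module.End.one_apply, AddMonoidAlgebra.coeff_single,
      Finsupp.single_apply, natConeSum]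
    refine if_congr ⟨?_, ?_⟩ rfl rfl
    · rintro ⟨z, -, h2, h3⟩
      have : z = 0 := funext fun j => h2 j (by simp)
      simpa [this] using h3.symm
    · rintro rfl; exact ⟨0, by simp, by simp, by simp⟩
  | insert j s hj ih =>
    rw [Finset.prod_insert hj, mul_comm, map_mul, Module.End.mul_apply, ← ih]
    congr 1
    funext x
    rw [map_sub, map_one, LinearMap.sub_apply, Pi.sub_apply, laurentAction_single, one_mul]
    exact natConeSum_sub_shift α₀ A hA hj x

lemma laurentEval_prod {n d : ℕ} (A : Matrix (Fin n) (Fin d) ℤ) :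
    laurentEval n (∏ j, (1 - AddMonoidAlgebra.single (A.col j) 1)) =
      ∏ j, (1 - yMono fun r => A r j) := by
  rw [map_prod]
  refine Finset.prod_congr rfl fun j _ => ?_
  rw [map_sub, map_one, laurentEval_single, map_one, one_mul]
  rfl

lemma one_sub_yMono_ne_zero {n : ℕ} {α : Fin n → ℤ} (h : α ≠ 0) : (1 - yMono α : YField n) ≠ 0 := by
  rw [sub_ne_zero, ← yMono_zero]
  exact fun e => h (yMono_injective e).symm

lemma prod_one_sub_yMono_ne_zero {n d : ℕ} (A : Matrix (Fin n) (Fin d) ℤ)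
    (hA : Function.Injective A.mulVec) : (∏ j, (1 - yMono fun r => A r j) : YField n) ≠ 0 := by
  refine Finset.prod_ne_zero_iff.2 fun j _ => one_sub_yMono_ne_zero fun h => ?_
  have h1 : A.mulVec (Pi.single j 1) = A.mulVec 0 := by
    rw [Matrix.mulVec_single_one, Matrix.mulVec_zero]; exact h
  simpa using congrFun (hA h1) j

/-- The generating function of a free affine semigroup. -/
lemma isFormalGenFun_natConeSum {n d : ℕ} (α₀ : Fin n → ℤ) (A : Matrix (Fin n) (Fin d) ℤ)
    (hA : Function.Injective A.mulVec) :
    IsFormalGenFun (natConeSum α₀ A Finset.univ) (coneTerm α₀ A) := by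
  have h0 := prod_one_sub_yMono_ne_zero A hA
  refine ⟨_, _, ?_, laurentAction_prod_natConeSum α₀ A hA Finset.univ, ?_⟩
  · intro h
    rw [← laurentEval_prod, h, map_zero] at h0
    exact h0 rfl
  · rw [laurentEval_prod, laurentEval_single, map_one, one_mul, coneTerm, div_mul_cancel₀ _ h0]

lemma GeneratesUnimodularCone.mulVec_injective {n d : ℕ} {A : Matrix (Fin n) (Fin d) ℤ}
    (hA : GeneratesUnimodularCone A) : Function.Injective A.mulVec := by
  intro z z' h
  have hli := Fintype.linearIndependent_iff.1 hA.1 (fun j => ((z j - z' j : ℤ) : ℝ)) (by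
    funext r
    have := congrFun h r
    simp only [Matrix.mulVec, dotProduct] at this
    have h2 : ((∑ j, A r j * z j : ℤ) : ℝ) = ((∑ j, A r j * z' j : ℤ) : ℝ) := by rw [this]
    push_cast at h2
    simp only [Finset.sum_apply, Pi.smul_apply, smul_eq_mul, Int.cast_sub, sub_mul,
      Finset.sum_sub_distrib, Pi.zero_apply, sub_eq_zero]
    simpa only [mul_comm] using h2)
  funext j
  have := hli j
  norm_cast at this
  omega

/-- The lattice points of a unimodular vertex cone. -/
lemma latticeIndicator_vertexCone {n d : ℕ} {A : Matrix (Fin n) (Fin d) ℤ}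
    (hA : GeneratesUnimodularCone A) {v : Fin n → ℚ} {γ : Fin n → ℤ} {k : Fin d → ℚ}
    (hv : ∀ r, v r = (γ r : ℚ) + ∑ j, k j * (A r j : ℚ)) :
    latticeIndicator (vertexCone v A) = natConeSum (ceilExponent γ k A) A Finset.univ := by
  classical
  have hvR : ∀ r, (v r : ℝ) = (γ r : ℝ) + ∑ j, (k j : ℝ) * (A r j : ℝ) := by
    intro r; rw [hv r]; push_cast; rfl
  funext x
  simp only [latticeIndicator, natConeSum, Set.indicator, Pi.one_apply]
  refine if_congr ⟨?_, ?_⟩ rfl rfl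
  · rintro ⟨κ, hκ, hx⟩
    have hmem : (fun r => ((x - γ) r : ℝ)) ∈
        Submodule.span ℝ (Set.range fun (j : Fin d) (r : Fin n) => (A r j : ℝ)) := by
      rw [Submodule.mem_span_range_iff_exists_fun]
      refine ⟨fun j => k j + κ j, ?_⟩
      funext r
      have := hx r
      rw [hvR r] at this
      simp only [Finset.sum_apply, Pi.smul_apply, smul_eq_mul, Pi.sub_apply, Int.cast_sub, this,
        add_mul, Finset.sum_add_distrib]
      ring
    obtain ⟨z, hz⟩ := Submodule.mem_span_range_iff_exists_fun ℤ |>.1 (hA.2 _ hmem)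
    have hz' : ∀ r, x r = γ r + ∑ j, z j * A r j := by
      intro r
      have := congrFun hz r
      simp only [Finset.sum_apply, Pi.smul_apply, smul_eq_mul, Pi.sub_apply] at this
      omega
    have hli := Fintype.linearIndependent_iff.1 hA.1 (fun j => (z j : ℝ) - (k j + κ j)) (by
      funext r
      have h1 : (x r : ℝ) = _ := hx r
      have h2 : (x r : ℝ) = γ r + ∑ j, (z j : ℝ) * A r j := by rw [hz' r]; push_cast; rfl
      rw [h2, hvR r] at h1
      simp only [Finset.sum_apply, Pi.smul_apply, smul_eq_mul, sub_mul, add_mul,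
        Finset.sum_sub_distrib, Finset.sum_add_distrib, Pi.zero_apply]
      linarith)
    -- The coordinates of `x - γ` are integers `z j = k j + κ j`, so `κ j ≥ 0` is equivalent to `z j
    -- ≥ ⌈k j⌉`. This is the origin of the ceilings.
    refine ⟨fun j => z j - ⌈k j⌉, fun j _ => ?_, by simp, ?_⟩
    · have h1 := hli j
      have h2 := hκ j
      have : ⌈k j⌉ ≤ z j := by
        rw [Int.ceil_le]
        have : (k j : ℝ) ≤ z j := by linarith
        exact_mod_cast this
      simpa using this
    · funext r
      simp only [Pi.add_apply, ceilExponent, Matrix.mulVec, dotProduct, hz' r, mul_sub,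
        Finset.sum_sub_distrib]
      simp only [mul_comm]; ring
  · rintro ⟨z, h1, -, h3⟩
    refine ⟨fun j => (⌈k j⌉ : ℝ) - k j + z j, fun j => ?_, fun r => ?_⟩
    · have h2 := h1 j (by simp)
      have h4 : (k j : ℝ) ≤ ⌈k j⌉ := by exact_mod_cast Int.le_ceil (k j)
      have h5 : (0 : ℝ) ≤ z j := by exact_mod_cast h2
      linarith
    · rw [h3, hvR r]
      simp only [Pi.add_apply, ceilExponent, Matrix.mulVec, dotProduct, add_mul, sub_mul,
        Finset.sum_sub_distrib, Finset.sum_add_distrib]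
      push_cast
      simp only [mul_comm]; ring

lemma isLatticeGenFun_unimodular {n d : ℕ} {A : Matrix (Fin n) (Fin d) ℤ}
    (hA : GeneratesUnimodularCone A) {v : Fin n → ℚ} {γ : Fin n → ℤ} {k : Fin d → ℚ}
    (hv : ∀ r, v r = (γ r : ℚ) + ∑ j, k j * (A r j : ℚ)) :
    IsLatticeGenFun (vertexCone v A) (coneTerm (ceilExponent γ k A) A) := by
  rw [isLatticeGenFun_iff, latticeIndicator_vertexCone hA hv]
  exact isFormalGenFun_natConeSum _ _ hA.mulVec_injective

/-! ### The constant term -/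

/-- The linear functional sending `λ^e` to `u^{-e/f}` if `f ∣ e` and to `0` otherwise. It computes
the constant coefficient of the remainder modulo `1 - u λ^f`. -/
def foldFunctional {K : Type} [Field K] (u : K) (f : ℕ) : Polynomial K →ₗ[K] K :=
  Polynomial.lsum fun e => if f ∣ e then (u⁻¹ ^ (e / f)) • LinearMap.id else 0

section foldFunctional

variable {K : Type} [Field K] (u : K) (f : ℕ)

lemma foldFunctional_monomial (e : ℕ) (c : K) :
    foldFunctional u f (Polynomial.monomial e c) = if f ∣ e then u⁻¹ ^ (e / f) * c else 0 := by
  rw [foldFunctional, Polynomial.lsum_apply, Polynomial.sum_monomial_index _ _ (by simp)]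
  split_ifs <;> simp

lemma foldFunctional_X_pow_mul (hf : 0 < f) (t : ℕ) (p : Polynomial K) :
    foldFunctional u f (Polynomial.X ^ (f * t) * p) = u⁻¹ ^ t * foldFunctional u f p := by
  induction p using Polynomial.induction_on' with
  | add p q hp hq => rw [mul_add, map_add, map_add, hp, hq, mul_add]
  | monomial e c =>
    rw [Polynomial.X_pow_mul_monomial, foldFunctional_monomial, foldFunctional_monomial]
    have h1 : f ∣ e + f * t ↔ f ∣ e := (Nat.dvd_add_left (dvd_mul_right f t))
    have h2 : (e + f * t) / f = e / f + t := Nat.add_mul_div_left e t hf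
    simp only [h1, h2]
    split_ifs
    · rw [pow_add]; ring
    · simp

/-- Under the functional `λ^f` acts as the scalar `u⁻¹`, hence `u λ^f` acts as `1`. -/
lemma foldFunctional_factor_mul (hf : 0 < f) (hu : u ≠ 0) (p : Polynomial K) :
    foldFunctional u f ((1 - Polynomial.C u * Polynomial.X ^ f) * p) = 0 := by
  have h := foldFunctional_X_pow_mul u f hf 1 p
  rw [mul_one, pow_one] at h
  rw [sub_mul, one_mul, map_sub, mul_assoc, ← Polynomial.smul_eq_C_mul, map_smul, h, smul_eq_mul,
    mul_inv_cancel_left₀ hu, sub_self]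

lemma foldFunctional_of_degree_lt (p : Polynomial K) (hp : p.degree < f) :
    foldFunctional u f p = p.eval 0 := by
  rw [← Polynomial.coeff_zero_eq_eval_zero]
  conv_lhs => rw [p.as_sum_support]
  rw [map_sum]
  simp only [foldFunctional_monomial]
  have : ∀ e ∈ p.support, (if f ∣ e then u⁻¹ ^ (e / f) * p.coeff e else 0) =
      if e = 0 then p.coeff 0 else 0 := by
    intro e he
    have hlt : e < f := by
      have := Polynomial.le_degree_of_mem_supp e he
      exact_mod_cast this.trans_lt hp
    by_cases h0 : e = 0
    · subst h0; simp
    · rw [if_neg, if_neg h0]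
      exact fun hd => absurd (Nat.le_of_dvd (Nat.pos_of_ne_zero h0) hd) (by omega)
  rw [Finset.sum_congr rfl this]
  simp only [Finset.sum_ite_eq', Polynomial.mem_support_iff]
  split_ifs with h
  · rfl
  · exact (Polynomial.notMem_support_iff.1 h).symm

/-- The power `(y_j λ^{a_j})^f` involves only `λ^f`, so it acts as the scalar `u⁻¹ ^ a_j * y_j ^ f`
and the whole product leaves the functional. -/
lemma foldFunctional_mul_prod (hf : 0 < f) {ι : Type*} (s : Finset ι) (y : ι → K) (a : ι → ℕ)
    (p : Polynomial K) :
    foldFunctional u f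
        ((∏ j ∈ s, (1 - (Polynomial.C (y j) * Polynomial.X ^ a j) ^ f)) * p) =
      (∏ j ∈ s, (1 - u⁻¹ ^ a j * y j ^ f)) * foldFunctional u f p := by
  classical
  induction s using Finset.induction_on with
  | empty => simp
  | insert j s hj ih =>
    rw [Finset.prod_insert hj, Finset.prod_insert hj, mul_assoc, mul_assoc, ← ih, mul_pow,
      ← Polynomial.C_pow, ← pow_mul, sub_mul, one_mul, map_sub, mul_assoc,
      ← Polynomial.smul_eq_C_mul, map_smul, mul_comm (a j) f, foldFunctional_X_pow_mul u f hf,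
      smul_eq_mul]
    ring

lemma foldFunctional_X_pow_mul_prod {ι : Type*} [Fintype ι] [DecidableEq ι] (y : ι → K)
    (a : ι → ℕ) (e : ℕ) :
    foldFunctional u f (Polynomial.X ^ e *
        ∏ j, ∑ r ∈ Finset.range f, (Polynomial.C (y j) * Polynomial.X ^ a j) ^ r) =
      ∑ r ∈ Fintype.piFinset fun _ : ι => Finset.range f,
        if f ∣ e + ∑ j, a j * r j then
          u⁻¹ ^ ((e + ∑ j, a j * r j) / f) * ∏ j, y j ^ r j else 0 := by
  rw [Finset.prod_univ_sum, Finset.mul_sum, map_sum]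
  refine Finset.sum_congr rfl fun r _ => ?_
  rw [← foldFunctional_monomial]
  congr 1
  simp only [mul_pow, Finset.prod_mul_distrib, ← pow_mul, Finset.prod_pow_eq_pow_sum,
    ← Polynomial.C_pow, ← map_prod]
  rw [mul_left_comm, ← pow_add, Polynomial.C_mul_X_pow_eq_monomial]

end foldFunctional

/-- The lattice point of `v + C(H)` with coordinates `r` after the first. -/
def boxPoint {d : ℕ} (f : ℕ) (a : Fin d → ℕ) (b : ℤ) (r : Fin d → ℕ) : Fin (d + 1) → ℤ :=
  Fin.cons ((b - ∑ j, (a j : ℤ) * r j) / f) fun j => (r j : ℤ)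

/-- The residues of the lattice points in the half-open fundamental parallelepiped of
`v + C(H)`. -/
def boxResidues {d : ℕ} (f : ℕ) (a : Fin d → ℕ) (b : ℤ) : Finset (Fin d → ℕ) :=
  (Fintype.piFinset fun _ : Fin d => Finset.range f).filter
    fun r => (f : ℤ) ∣ b - ∑ j, (a j : ℤ) * r j

/-- An explicit formula for the constant term. -/
def denumerantCT {d : ℕ} (f : ℕ) (a : Fin d → ℕ) (b : ℤ) : YField (d + 1) :=
  ∑ r ∈ boxResidues f a b, coneTerm (boxPoint f a b r) (denumerantMatrix f a)

lemma yMono_cons {d : ℕ} (m : ℤ) (z : Fin d → ℤ) :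
    (yMono (Fin.cons m z) : YField (d + 1)) = yVar 0 ^ m * ∏ j, yVar j.succ ^ z j := by
  simp [yMono, Fin.prod_univ_succ]

lemma yMono_denumerantMatrix {d : ℕ} (f : ℕ) (a : Fin d → ℕ) (j : Fin d) :
    (yMono fun r => denumerantMatrix f a r j : YField (d + 1)) =
      (yVar 0)⁻¹ ^ a j * yVar j.succ ^ f := by
  rw [yMono, Fin.prod_univ_succ]
  congr 1
  · simp [denumerantMatrix]
  · rw [Finset.prod_eq_single j]
    · simp [denumerantMatrix]
    · intro i _ hi; simp [denumerantMatrix, hi]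
    · simp

lemma denumerantMatrix_mulVec_succ {d : ℕ} (f : ℕ) (a : Fin d → ℕ) (z : Fin d → ℤ) (j : Fin d) :
    (denumerantMatrix f a).mulVec z j.succ = f * z j := by
  simp [denumerantMatrix, Matrix.mulVec, dotProduct]

lemma denumerantMatrix_mulVec_zero {d : ℕ} (f : ℕ) (a : Fin d → ℕ) (z : Fin d → ℤ) :
    (denumerantMatrix f a).mulVec z 0 = -∑ j, a j * z j := by
  simp [denumerantMatrix, Matrix.mulVec, dotProduct]

lemma denumerantMatrix_mulVec_injective {d : ℕ} {f : ℕ} (hf : 0 < f) (a : Fin d → ℕ) :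
    Function.Injective (denumerantMatrix f a).mulVec := by
  intro z z' h
  funext j
  have := congrFun h j.succ
  rw [denumerantMatrix_mulVec_succ, denumerantMatrix_mulVec_succ] at this
  exact mul_left_cancel₀ (by positivity) this

/-- Clearing denominators in a partial fraction decomposition. -/
lemma IsUnderlinedCT.exists_polynomial {K : Type} [Field K] {n : ℕ} {b : ℤ} {u : Fin (n + 1) → K}
    {w : Fin (n + 1) → ℕ} {c : K} (hw : ∀ i, 0 < w i)
    (h : IsUnderlinedCT (RatFunc.X ^ (-b) / (ctFactor (u 0) (w 0) *
      ∏ j : Fin n, ctFactor (u j.succ) (w j.succ))) u w 0 c) :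
    ∃ (A Q : Polynomial K) (t e : ℕ), A.degree < w 0 ∧ c = A.eval 0 ∧ (e : ℤ) = w 0 * t - b ∧
      Polynomial.X ^ (w 0 * t) * A *
        ∏ j : Fin n, (1 - Polynomial.C (u j.succ) * Polynomial.X ^ w j.succ) =
      Polynomial.X ^ e + (1 - Polynomial.C (u 0) * Polynomial.X ^ w 0) * Q := by
  classical
  obtain ⟨P, p, m, A, hp, hA, hE, hc⟩ := h
  set g : Fin (n + 1) → Polynomial K :=
    fun i => 1 - Polynomial.C (u i) * Polynomial.X ^ w i with hg
  have hgmap : ∀ i, algebraMap (Polynomial K) (RatFunc K) (g i) = ctFactor (u i) (w i) := by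
    intro i
    simp [hg, ctFactor, RatFunc.algebraMap_C, RatFunc.algebraMap_X]
  have hg0 : ∀ i, ctFactor (u i) (w i) ≠ 0 := by
    intro i
    rw [← hgmap, Ne, map_eq_zero_iff _ (RatFunc.algebraMap_injective K)]
    intro h
    have := congrArg (Polynomial.eval 0) h
    simp [hg, (hw i).ne'] at this
  -- The power `λ^(w 0 * t)` clears both `λ^m` and `λ^(-b)`. Its exponent is kept a multiple of `w
  -- 0` so that the folding functional turns it into a scalar.
  set t : ℕ := m + b.natAbs with ht
  have hle : t ≤ w 0 * t := Nat.le_mul_of_pos_left t (hw 0)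
  obtain ⟨e, he⟩ : ∃ e : ℕ, (e : ℤ) = w 0 * t - b :=
    ⟨((w 0 * t : ℕ) - b : ℤ).toNat, by
      rw [Int.toNat_of_nonneg] <;> push_cast <;> zify at hle <;> omega⟩
  set G : Polynomial K := ∏ j : Fin n, g j.succ with hG
  have hGmap : algebraMap (Polynomial K) (RatFunc K) G =
      ∏ j : Fin n, ctFactor (u j.succ) (w j.succ) := by
    rw [hG, map_prod]; exact Finset.prod_congr rfl fun j _ => hgmap _
  have hG0 : (∏ j : Fin n, ctFactor (u j.succ) (w j.succ)) ≠ 0 :=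
    Finset.prod_ne_zero_iff.2 fun j _ => hg0 _
  have hX : (RatFunc.X : RatFunc K) ≠ 0 := RatFunc.X_ne_zero
  set T : Polynomial K :=
    ∑ j : Fin n, A j.succ * ∏ i ∈ Finset.univ.erase j, g i.succ with hT
  have hTmap : (∑ j : Fin n, algebraMap (Polynomial K) (RatFunc K) (A j.succ) /
      ctFactor (u j.succ) (w j.succ)) * (∏ j : Fin n, ctFactor (u j.succ) (w j.succ)) =
      algebraMap (Polynomial K) (RatFunc K) T := by
    rw [hT, map_sum, Finset.sum_mul]
    refine Finset.sum_congr rfl fun j _ => ?_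
    rw [← Finset.mul_prod_erase Finset.univ _ (Finset.mem_univ j), map_mul, map_prod,
      ← mul_assoc, div_mul_cancel₀ _ (hg0 _)]
    congr 1
    exact Finset.prod_congr rfl fun i _ => (hgmap _).symm
  obtain ⟨l, hl⟩ : ∃ l, w 0 * t = l + m := ⟨w 0 * t - m, by omega⟩
  refine ⟨A 0, -(G * Polynomial.X ^ (w 0 * t) * P + G * Polynomial.X ^ l * p +
    Polynomial.X ^ (w 0 * t) * T), t, e, hA 0, hc, he, ?_⟩
  apply RatFunc.algebraMap_injective K
  change algebraMap _ _ (_ * G) = algebraMap _ _ (_ + g 0 * _)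
  simp only [map_mul, map_add, map_neg, map_pow, RatFunc.algebraMap_X, hGmap, hgmap, ← hTmap]
  rw [Fin.sum_univ_succ] at hE
  have hxe : (RatFunc.X : RatFunc K) ^ e = RatFunc.X ^ (w 0 * t) * RatFunc.X ^ (-b) := by
    rw [← zpow_natCast, ← zpow_natCast, ← zpow_add₀ hX, he]; push_cast; rfl
  have hE' : (RatFunc.X : RatFunc K) ^ (-b) =
      (algebraMap (Polynomial K) (RatFunc K) P
        + algebraMap (Polynomial K) (RatFunc K) p / RatFunc.X ^ m
        + (algebraMap (Polynomial K) (RatFunc K) (A 0) / ctFactor (u 0) (w 0) +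
          ∑ j : Fin n, algebraMap (Polynomial K) (RatFunc K) (A j.succ) /
            ctFactor (u j.succ) (w j.succ))) *
      (ctFactor (u 0) (w 0) * ∏ j : Fin n, ctFactor (u j.succ) (w j.succ)) := by
    rw [← hE, div_mul_cancel₀ _ (mul_ne_zero (hg0 0) hG0)]
  rw [hxe, hE', hl, pow_add]
  have := hg0 0
  generalize (∑ j : Fin n, algebraMap (Polynomial K) (RatFunc K) (A j.succ) /
            ctFactor (u j.succ) (w j.succ)) = Y
  field_simp
  ring

/-- Only the value `A_0(0)` is determined here, by applying the folding functional to the cleared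
identity. No uniqueness of the whole decomposition is needed. -/
lemma IsDenumerantCT.eq_denumerantCT {d : ℕ} {f : ℕ} {a : Fin d → ℕ} {b : ℤ} (hf : 0 < f)
    (ha : ∀ j, 0 < a j) {c : YField (d + 1)} (h : IsDenumerantCT f a b c) :
    c = denumerantCT f a b := by
  classical
  obtain ⟨A, Q, t, e, hA, hc, he, hpoly⟩ := IsUnderlinedCT.exists_polynomial (b := b) (u := yVar)
    (w := Fin.cons f a) (c := c) (Fin.cases (by simpa) (by simpa)) h
  simp only [Fin.cons_zero, Fin.cons_succ] at hA he hpoly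
  set y₀ : YField (d + 1) := yVar 0 with hy₀
  have hy0 : y₀ ≠ 0 := yVar_ne_zero 0
  -- The geometric sums complete each `1 - y_j λ^{a_j}` on the left to `1 - (y_j λ^{a_j})^f`. On the
  -- right they expand to the box sum, while the multiple of `1 - y_0 λ^f` disappears.
  have key := congrArg (fun p => foldFunctional y₀ f
    (p * ∏ j : Fin d, ∑ r ∈ Finset.range f,
      (Polynomial.C (yVar j.succ) * Polynomial.X ^ a j) ^ r)) hpoly
  beta_reduce at key
  rw [add_mul, map_add, mul_assoc (1 - _ : Polynomial _), foldFunctional_factor_mul _ _ hf hy0,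
    add_zero, foldFunctional_X_pow_mul_prod, mul_assoc, mul_assoc, ← Finset.prod_mul_distrib] at key
  simp only [mul_neg_geom_sum] at key
  rw [foldFunctional_X_pow_mul _ _ hf, mul_comm A, foldFunctional_mul_prod _ _ hf,
    foldFunctional_of_degree_lt _ _ _ hA, ← hc] at key
  have hne := prod_one_sub_yMono_ne_zero _ (denumerantMatrix_mulVec_injective hf a)
  simp only [denumerantCT, coneTerm, ← Finset.sum_div]
  rw [eq_div_iff hne]
  simp only [yMono_denumerantMatrix]
  have hpt : y₀⁻¹ ^ t ≠ 0 := pow_ne_zero _ (inv_ne_zero hy0)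
  apply mul_left_cancel₀ hpt
  rw [mul_comm c, key, boxResidues, Finset.sum_filter, Finset.mul_sum]
  refine Finset.sum_congr rfl fun r _ => ?_
  have hdvd : f ∣ e + ∑ j, a j * r j ↔ (f : ℤ) ∣ b - ∑ j, (a j : ℤ) * r j := by
    rw [← Int.natCast_dvd_natCast]
    push_cast
    rw [he]
    have : (f : ℤ) * t - b + ∑ j, (a j : ℤ) * r j = f * t - (b - ∑ j, (a j : ℤ) * r j) := by ring
    rw [this]
    exact dvd_sub_right (dvd_mul_right _ _)
  simp only [hdvd]
  split_ifs with hd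
  · have hd' := hdvd.2 hd
    obtain ⟨q, hq⟩ := hd
    obtain ⟨q', hq'⟩ := hd'
    have hfz : (f : ℤ) ≠ 0 := by positivity
    have hqq : (q' : ℤ) = t - q := by
      have : ((e + ∑ j, a j * r j : ℕ) : ℤ) = ((f * q' : ℕ) : ℤ) := by rw [hq']
      push_cast at this
      rw [he] at this
      apply mul_left_cancel₀ hfz
      linarith
    rw [boxPoint, yMono_cons, hq, Int.mul_ediv_cancel_left _ hfz, hq', Nat.mul_div_cancel_left _ hf,
      ← mul_assoc]
    congr 1
    rw [← zpow_natCast, ← zpow_natCast, hqq, inv_zpow', inv_zpow', ← zpow_add₀ hy0]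
    congr 1; ring
  · simp

/-- Existence of partial fraction decompositions with binomial denominators. -/
lemma exists_isUnderlinedCT {K : Type} [Field K] {n : ℕ} (u : Fin n → K) (w : Fin n → ℕ)
    (hu : ∀ i, u i ≠ 0) (hw : ∀ i, 0 < w i) (huw : ∀ i j, i ≠ j → u i ^ w j ≠ u j ^ w i)
    (b : ℤ) (i₀ : Fin n) :
    ∃ c, IsUnderlinedCT (RatFunc.X ^ (-b) / ∏ i, ctFactor (u i) (w i)) u w i₀ c := by
  classical
  set m := b.natAbs with hm
  obtain ⟨e, he⟩ : ∃ e : ℕ, (e : ℤ) = m - b := ⟨(m - b : ℤ).toNat, by omega⟩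
  -- Monic pairwise coprime denominators: `none` indexes `λ^m`, and `some i` indexes `-(u i)⁻¹`
  -- times the binomial `1 - u_i λ^{w_i}`.
  set g : Option (Fin n) → Polynomial K := fun o =>
    o.elim (Polynomial.X ^ m) fun i => Polynomial.X ^ w i - Polynomial.C (u i)⁻¹ with hg
  have hmon : ∀ o ∈ (Finset.univ : Finset (Option (Fin n))), (g o).Monic := by
    rintro (_ | i) -
    · exact Polynomial.monic_X_pow m
    · exact Polynomial.monic_X_pow_sub_C _ (hw i).ne'
  have hcopX : ∀ i, IsCoprime (g none) (g (some i)) := by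
    intro i
    refine IsCoprime.pow_left ?_
    refine ⟨Polynomial.C (u i) * Polynomial.X ^ (w i - 1), -Polynomial.C (u i), ?_⟩
    simp only [hg, Option.elim]
    rw [mul_assoc, ← pow_succ, Nat.sub_add_cancel (hw i), mul_sub, neg_mul, neg_mul,
      ← Polynomial.C_mul, mul_inv_cancel₀ (hu i)]
    simp
  have hcop : ∀ i j, i ≠ j → IsCoprime (g (some i)) (g (some j)) := by
    intro i j hij
    have hdiv : ∀ i j, g (some i) ∣ Polynomial.X ^ (w i * w j) - Polynomial.C ((u i)⁻¹ ^ w j) := by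
      intro i j
      rw [pow_mul, Polynomial.C_pow]
      exact sub_dvd_pow_sub_pow _ _ _
    -- The two factors divide `X^(w_i w_j) - c` and `X^(w_i w_j) - c'` with `c ≠ c'`, and these
    -- differ by a nonzero constant.
    refine IsCoprime.of_isCoprime_of_dvd_left (IsCoprime.of_isCoprime_of_dvd_right ?_ (hdiv j i))
      (hdiv i j)
    set δ : K := (u j)⁻¹ ^ w i - (u i)⁻¹ ^ w j with hδ
    have hδ0 : δ ≠ 0 := by
      rw [hδ, sub_ne_zero, inv_pow, inv_pow]
      intro h
      exact huw i j hij (inv_injective h).symm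
    refine ⟨Polynomial.C δ⁻¹, -Polynomial.C δ⁻¹, ?_⟩
    rw [mul_comm (w j) (w i), neg_mul, ← sub_eq_add_neg, ← mul_sub, sub_sub_sub_cancel_left,
      ← Polynomial.C_sub, ← Polynomial.C_mul, inv_mul_cancel₀ hδ0, Polynomial.C_1]
  obtain ⟨q, r, hr, hsum⟩ := Polynomial.div_prod_eq_quo_add_sum_rem_div (RatFunc K)
    (Polynomial.C (∏ i, (-(u i)⁻¹)) * Polynomial.X ^ e) hmon (by
      rintro (_ | i) - (_ | j) - hij
      · exact absurd rfl hij
      · exact hcopX j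
      · exact (hcopX i).symm
      · exact hcop i j fun h => hij (by rw [h]))
  -- The factor `-u_i` undoes the normalization to monic denominators.
  refine ⟨_, q, r none, m, fun i => -Polynomial.C (u i) * r (some i), ?_, ?_, ?_, rfl⟩
  · have := hr none (Finset.mem_univ _)
    simpa [hg] using this
  · intro i
    have := hr (some i) (Finset.mem_univ _)
    simp only [hg, Option.elim] at this
    rw [Polynomial.degree_X_pow_sub_C (hw i)] at this
    beta_reduce
    rwa [neg_mul, Polynomial.degree_neg, Polynomial.degree_C_mul (hu i)]
  · have hgi : ∀ i, algebraMap (Polynomial K) (RatFunc K) (g (some i)) =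
        RatFunc.C (-(u i)⁻¹) * ctFactor (u i) (w i) := by
      intro i
      have : (RatFunc.C (u i)⁻¹ * RatFunc.C (u i) : RatFunc K) = 1 := by
        rw [← map_mul, inv_mul_cancel₀ (hu i), map_one]
      simp only [hg, Option.elim, map_sub, map_pow, RatFunc.algebraMap_X, RatFunc.algebraMap_C,
        ctFactor, map_neg]
      linear_combination (-RatFunc.X ^ w i) * this
    have hC : ∀ i, (RatFunc.C (-(u i)⁻¹) : RatFunc K) ≠ 0 := by
      intro i
      rw [Ne, map_eq_zero]
      exact neg_ne_zero.2 (inv_ne_zero (hu i))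
    rw [Fintype.sum_option, Fintype.prod_option] at hsum
    simp only [hgi, Finset.prod_mul_distrib] at hsum
    rw [add_assoc]
    have hX : (RatFunc.X : RatFunc K) ≠ 0 := RatFunc.X_ne_zero
    convert hsum using 1
    · have : (RatFunc.X : RatFunc K) ^ (-b) = RatFunc.X ^ e / RatFunc.X ^ m := by
        rw [← zpow_natCast, ← zpow_natCast, ← zpow_sub₀ hX, he]; congr 1; ring
      rw [this]
      simp only [hg, Option.elim, map_mul, map_pow, map_prod, RatFunc.algebraMap_X,
        RatFunc.algebraMap_C]
      have : (∏ i, RatFunc.C (-(u i)⁻¹) : RatFunc K) ≠ 0 :=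
        Finset.prod_ne_zero_iff.2 fun i _ => hC i
      rw [mul_left_comm, mul_div_mul_left _ _ this, div_div]
    · congr 1
      congr 1
      · simp [hg]
      · refine Finset.sum_congr rfl fun i _ => ?_
        have h1 : (RatFunc.C (-(u i)⁻¹) * -RatFunc.C (u i) : RatFunc K) = 1 := by
          rw [← map_neg, ← map_mul, neg_mul_neg, inv_mul_cancel₀ (hu i), map_one]
        rw [← mul_div_mul_left _ _ (hC i)]
        congr 1
        simp only [map_mul, map_neg, RatFunc.algebraMap_C] at h1 ⊢
        linear_combination (algebraMap (Polynomial K) (RatFunc K) (r (some i))) * h1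

lemma yVar_pow_ne {n : ℕ} {i j : Fin n} (hij : i ≠ j) {s t : ℕ} (hs : 0 < s) :
    (yVar i ^ s : YField n) ≠ yVar j ^ t := by
  have h : ∀ (i : Fin n) (s : ℕ), (yVar i ^ s : YField n) = yMono (Pi.single i (s : ℤ)) := by
    intro i s
    rw [yMono, Finset.prod_eq_single i]
    · simp
    · intro k _ hk; simp [hk]
    · simp
  rw [h, h]
  intro e
  have := congrFun (yMono_injective e) i
  simp [hij] at this
  omega

lemma isDenumerantCT_iff {d : ℕ} {f : ℕ} {a : Fin d → ℕ} {b : ℤ} (hf : 0 < f)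
    (ha : ∀ j, 0 < a j) (c : YField (d + 1)) :
    IsDenumerantCT f a b c ↔ c = denumerantCT f a b := by
  refine ⟨fun h => h.eq_denumerantCT hf ha, ?_⟩
  rintro rfl
  have hw : ∀ i, 0 < (Fin.cons f a : Fin (d + 1) → ℕ) i := Fin.cases (by simpa) (by simpa)
  obtain ⟨c, hc⟩ := exists_isUnderlinedCT (K := YField (d + 1)) yVar (Fin.cons f a)
    (fun i => yVar_ne_zero i) hw (fun i j hij => yVar_pow_ne hij (hw j)) b 0
  have hc' : IsDenumerantCT f a b c := by
    rw [Fin.prod_univ_succ] at hc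
    simpa [IsDenumerantCT, denumerantFun] using hc
  rwa [← hc'.eq_denumerantCT hf ha]

/-! ### The generating function of `v + C(H)` -/

/-- The lower rows of `H` force `k_j = x_j / f`; the first row then becomes the equation `f x_0 + ∑
a_j x_j = b`. The coordinate `x_0` has no sign condition. -/
lemma mem_vertexCone_denumerant {d f : ℕ} (hf : 0 < f) (a : Fin d → ℕ) (b : ℤ)
    (x : Fin (d + 1) → ℤ) :
    (fun i => (x i : ℝ)) ∈ vertexCone (denumerantVertex d f b) (denumerantMatrix f a) ↔
      (∀ j : Fin d, 0 ≤ x j.succ) ∧ f * x 0 + ∑ j : Fin d, a j * x j.succ = b := by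
  have hfR : (0 : ℝ) < f := by exact_mod_cast hf
  have hrow : ∀ (k : Fin d → ℝ) (j : Fin d),
      ∑ i, k i * (denumerantMatrix f a j.succ i : ℝ) = k j * f := by
    intro k j; simp [denumerantMatrix]
  have hrow0 : ∀ (k : Fin d → ℝ),
      ∑ i, k i * (denumerantMatrix f a 0 i : ℝ) = -∑ j, k j * a j := by
    intro k; simp [denumerantMatrix]
  constructor
  · rintro ⟨k, hk, hx⟩
    have h0 := hx 0
    rw [hrow0] at h0
    have hs : ∀ j : Fin d, (x j.succ : ℝ) = k j * f := by
      intro j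
      have := hx j.succ
      rw [hrow] at this
      simpa [denumerantVertex] using this
    refine ⟨fun j => ?_, ?_⟩
    · have : (0 : ℝ) ≤ x j.succ := by rw [hs]; exact mul_nonneg (hk j) hfR.le
      exact_mod_cast this
    · have : (f : ℝ) * x 0 + ∑ j : Fin d, (a j : ℝ) * x j.succ = b := by
        simp only [hs]
        simp only [denumerantVertex, Pi.single_eq_same] at h0
        rw [h0]
        push_cast
        rw [mul_add, mul_div_cancel₀ _ hfR.ne', mul_neg, Finset.mul_sum]
        have : ∀ j : Fin d, (a j : ℝ) * (k j * f) = f * (k j * a j) := fun j => by ring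
        simp [this]
      exact_mod_cast this
  · rintro ⟨h1, h2⟩
    refine ⟨fun j => (x j.succ : ℝ) / f, fun j => ?_, ?_⟩
    · have : (0 : ℝ) ≤ x j.succ := by exact_mod_cast h1 j
      positivity
    · refine Fin.cases ?_ fun j => ?_
      · rw [hrow0]
        have h3 : (f : ℝ) * x 0 + ∑ j : Fin d, (a j : ℝ) * x j.succ = b := by exact_mod_cast h2
        simp only [denumerantVertex, Pi.single_eq_same]
        push_cast
        have : ∀ j : Fin d, (x j.succ : ℝ) / f * a j = (a j * x j.succ) / f := fun j => by ring
        simp only [this, ← Finset.sum_div]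
        rw [← h3]
        field_simp
        ring
      · rw [hrow, div_mul_cancel₀ _ hfR.ne']
        simp [denumerantVertex]

/-- Division with remainder `x_j = r_j + f z_j` splits the lattice points of the cone into
translates of the semigroup generated by the columns of `H`, one for each residue vector. The
equation determines `x_0`. -/
lemma exists_eq_boxPoint_add {d f : ℕ} (hf : 0 < f) (a : Fin d → ℕ) (b : ℤ) {r : Fin d → ℕ}
    (hr : r ∈ boxResidues f a b) (x : Fin (d + 1) → ℤ) :
    (∃ z : Fin d → ℤ, (∀ j ∈ (Finset.univ : Finset (Fin d)), 0 ≤ z j) ∧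
      (∀ j ∉ (Finset.univ : Finset (Fin d)), z j = 0) ∧
      x = boxPoint f a b r + (denumerantMatrix f a).mulVec z) ↔
    ((∀ j : Fin d, 0 ≤ x j.succ) ∧ f * x 0 + ∑ j : Fin d, a j * x j.succ = b) ∧
      r = fun j => (x j.succ % f).toNat := by
  obtain ⟨hr1, q, hq⟩ := Finset.mem_filter.1 hr
  have hfz : (0 : ℤ) < f := by exact_mod_cast hf
  have hrlt : ∀ j, r j < f := fun j => by simpa using Fintype.mem_piFinset.1 hr1 j
  have hp0 : boxPoint f a b r 0 = q := by
    rw [boxPoint, Fin.cons_zero, hq, Int.mul_ediv_cancel_left _ hfz.ne']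
  constructor
  · rintro ⟨z, hz, -, hx⟩
    have hs : ∀ j : Fin d, x j.succ = r j + f * z j := by
      intro j
      rw [hx, Pi.add_apply, denumerantMatrix_mulVec_succ]; simp [boxPoint]
    have h0 : x 0 = q - ∑ j, a j * z j := by
      rw [hx, Pi.add_apply, denumerantMatrix_mulVec_zero, hp0]; ring
    refine ⟨⟨fun j => ?_, ?_⟩, ?_⟩
    · rw [hs]; have := hz j (Finset.mem_univ _); positivity
    · simp only [hs, h0, mul_add, Finset.sum_add_distrib, mul_sub, ← hq, Finset.mul_sum]
      have : ∀ j : Fin d, (a j : ℤ) * (f * z j) = f * (a j * z j) := fun j => by ring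
      simp [this]
    · funext j
      rw [hs, Int.add_mul_emod_self_left, Int.emod_eq_of_lt (by positivity)
        (by exact_mod_cast hrlt j), Int.toNat_natCast]
  · rintro ⟨⟨h1, h2⟩, h3⟩
    have hs : ∀ j : Fin d, (r j : ℤ) = x j.succ % f := by
      intro j
      rw [h3, Int.toNat_of_nonneg (Int.emod_nonneg _ hfz.ne')]
    refine ⟨fun j => x j.succ / f, fun j _ => Int.ediv_nonneg (h1 j) hfz.le, by simp, ?_⟩
    funext i
    refine Fin.cases ?_ (fun j => ?_) i
    · rw [Pi.add_apply, denumerantMatrix_mulVec_zero, hp0]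
      apply mul_left_cancel₀ hfz.ne'
      rw [mul_add, ← hq, ← h2]
      simp only [hs, Int.emod_def, mul_sub, Finset.sum_sub_distrib, mul_neg, Finset.mul_sum]
      have : ∀ j : Fin d, (a j : ℤ) * (f * (x j.succ / f)) = f * (a j * (x j.succ / f)) :=
        fun j => by ring
      simp only [this]
      ring
    · rw [Pi.add_apply, denumerantMatrix_mulVec_succ]
      simp only [boxPoint, Fin.cons_succ, hs]
      exact (Int.emod_add_mul_ediv _ _).symm

lemma latticeIndicator_denumerant {d f : ℕ} (hf : 0 < f) (a : Fin d → ℕ) (b : ℤ) :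
    latticeIndicator (vertexCone (denumerantVertex d f b) (denumerantMatrix f a)) =
      ∑ r ∈ boxResidues f a b,
        natConeSum (boxPoint f a b r) (denumerantMatrix f a) Finset.univ := by
  classical
  funext x
  rw [Finset.sum_apply]
  have h1 : ∀ r ∈ boxResidues f a b,
      natConeSum (boxPoint f a b r) (denumerantMatrix f a) Finset.univ x =
      if ((∀ j : Fin d, 0 ≤ x j.succ) ∧ f * x 0 + ∑ j : Fin d, a j * x j.succ = b) ∧
        r = fun j => (x j.succ % f).toNat then 1 else 0 := by
    intro r hr
    unfold natConeSum
    exact if_congr (exists_eq_boxPoint_add hf a b hr x) rfl rfl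
  rw [Finset.sum_congr rfl h1]
  simp only [latticeIndicator, Set.indicator, mem_vertexCone_denumerant hf, Pi.one_apply]
  by_cases hx : (∀ j : Fin d, 0 ≤ x j.succ) ∧ f * x 0 + ∑ j : Fin d, a j * x j.succ = b
  · rw [if_pos hx]
    simp only [and_iff_right hx]
    rw [Finset.sum_ite_eq', if_pos]
    have hfz : (0 : ℤ) < f := by exact_mod_cast hf
    have hnn : ∀ j : Fin d, ((x j.succ % f).toNat : ℤ) = x j.succ % f := fun j =>
      Int.toNat_of_nonneg (Int.emod_nonneg _ hfz.ne')
    rw [boxResidues, Finset.mem_filter, Fintype.mem_piFinset]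
    refine ⟨fun j => ?_, ?_⟩
    · rw [Finset.mem_range]
      have h2 := Int.emod_lt_of_pos (x j.succ) hfz
      have h3 := hnn j
      omega
    · simp only [hnn]
      simp only [← hx.2, Int.emod_def, mul_sub, Finset.sum_sub_distrib]
      refine ⟨x 0 + ∑ j : Fin d, a j * (x j.succ / f), ?_⟩
      have : ∀ j : Fin d, (a j : ℤ) * (f * (x j.succ / f)) = f * (a j * (x j.succ / f)) :=
        fun j => by ring
      simp only [this, ← Finset.mul_sum]
      ring
  · simp [hx]

lemma isLatticeGenFun_denumerantCT {d f : ℕ} (hf : 0 < f) (a : Fin d → ℕ) (b : ℤ) :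
    IsLatticeGenFun (vertexCone (denumerantVertex d f b) (denumerantMatrix f a))
      (denumerantCT f a b) := by
  rw [isLatticeGenFun_iff, latticeIndicator_denumerant hf]
  exact IsFormalGenFun.sum _ fun r _ =>
    isFormalGenFun_natConeSum _ _ (denumerantMatrix_mulVec_injective hf a)

/-! ### Flattening transformations -/

lemma exists_bezout {d f : ℕ} {a : Fin d → ℕ} (hg : Nat.gcd f (Finset.univ.gcd a) = 1) :
    ∃ (s : ℤ) (t : Fin d → ℤ), f * s + ∑ j, a j * t j = 1 := by
  obtain ⟨t, ht⟩ : ∃ t : Fin d → ℤ, ∑ j, (a j : ℤ) * t j = (Finset.univ.gcd a : ℕ) := by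
    have h2 : ∀ s : Finset (Fin d), ∃ t : Fin d → ℤ, ∑ j ∈ s, (a j : ℤ) * t j = (s.gcd a : ℕ) := by
      intro s
      induction s using Finset.induction_on with
      | empty => exact ⟨0, by simp⟩
      | insert j s hj ih =>
        obtain ⟨t, ht⟩ := ih
        refine ⟨fun i => if i = j then Nat.gcdA (a j) (s.gcd a) else
          t i * Nat.gcdB (a j) (s.gcd a), ?_⟩
        beta_reduce
        rw [Finset.sum_insert hj, if_pos rfl, Finset.gcd_insert]
        change _ = ((Nat.gcd (a j) (s.gcd a) : ℕ) : ℤ)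
        rw [Nat.gcd_eq_gcd_ab, ← ht, Finset.sum_mul]
        congr 1
        refine Finset.sum_congr rfl fun i hi => ?_
        rw [if_neg (fun h : i = j => hj (h ▸ hi))]; ring
    exact h2 Finset.univ
  refine ⟨Nat.gcdA f (Finset.univ.gcd a), fun j => t j * Nat.gcdB f (Finset.univ.gcd a), ?_⟩
  have h := Nat.gcd_eq_gcd_ab f (Finset.univ.gcd a)
  rw [hg, ← ht, Finset.sum_mul] at h
  simp only [mul_assoc] at h
  exact_mod_cast h.symm

/-- The row vector `(f, a_1, …, a_d)`. -/
def denumerantRow {d : ℕ} (f : ℕ) (a : Fin d → ℕ) : Fin (d + 1) → ℤ :=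
  Fin.cons f fun j => (a j : ℤ)

lemma mul_denumerantMatrix_apply {d f : ℕ} (a : Fin d → ℕ)
    (U : Matrix (Fin (d + 1)) (Fin (d + 1)) ℤ) (i : Fin (d + 1)) (j : Fin d) :
    (U * denumerantMatrix f a) i j = -(U i 0 * a j) + U i j.succ * f := by
  rw [Matrix.mul_apply, Fin.sum_univ_succ]
  simp [denumerantMatrix]

/-- Row zero annihilates `H`, so it is proportional to `(f, a)`, and Bézout makes the factor `m` an
integer. As `m` divides `det U` it is a unit, and the sign condition leaves `m = 1`. -/
lemma IsFlattening.first_row {d f : ℕ} {a : Fin d → ℕ} (hf : 0 < f)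
    (hg : Nat.gcd f (Finset.univ.gcd a) = 1) {U : Matrix (Fin (d + 1)) (Fin (d + 1)) ℤ}
    (hU : IsFlattening (denumerantMatrix f a) U) : U 0 = denumerantRow f a := by
  obtain ⟨hdet, hzero, hpos⟩ := hU
  obtain ⟨s, t, hst⟩ := exists_bezout hg
  have hrow : ∀ j : Fin d, U 0 0 * a j = U 0 j.succ * f := by
    intro j
    have := hzero j
    rw [mul_denumerantMatrix_apply] at this
    linarith
  set m : ℤ := U 0 0 * s + ∑ j : Fin d, U 0 j.succ * t j with hm
  have h0 : U 0 0 = f * m := by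
    have : U 0 0 = U 0 0 * (f * s + ∑ j, a j * t j) := by rw [hst, mul_one]
    rw [this, hm, mul_add, mul_add, Finset.mul_sum, Finset.mul_sum]
    congr 1
    · ring
    · refine Finset.sum_congr rfl fun j _ => ?_
      rw [← mul_assoc, hrow]; ring
  have hfz : (0 : ℤ) < f := by exact_mod_cast hf
  have hall : U 0 = m • denumerantRow f a := by
    funext i
    refine Fin.cases ?_ (fun j => ?_) i
    · simp [denumerantRow, h0, mul_comm]
    · apply mul_right_cancel₀ hfz.ne'
      rw [← hrow, h0]
      simp [denumerantRow]; ring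
  have hmdvd : m ∣ U.det := by
    have : U = U.updateRow 0 (m • denumerantRow f a) := by rw [← hall, Matrix.updateRow_eq_self]
    rw [this, Matrix.det_updateRow_smul]
    exact dvd_mul_right _ _
  have hmu : IsUnit m := isUnit_of_dvd_unit hmdvd hdet
  have hmnn : 0 ≤ m := by
    rw [h0] at hpos
    exact nonneg_of_mul_nonneg_right hpos hfz
  have : m = 1 := by
    rcases Int.isUnit_iff.1 hmu with h | h <;> omega
  rw [hall, this, one_smul]

lemma isFlattening_of_row {d f : ℕ} {a : Fin d → ℕ}
    {U : Matrix (Fin (d + 1)) (Fin (d + 1)) ℤ} (hdet : IsUnit U.det)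
    (hrow : U 0 = denumerantRow f a) : IsFlattening (denumerantMatrix f a) U := by
  refine ⟨hdet, fun j => ?_, ?_⟩
  · rw [mul_denumerantMatrix_apply, hrow]; simp [denumerantRow]; ring
  · rw [hrow]; simp [denumerantRow]

/-- A Bézout vector `y` splits `ℤ^(d+1)` as `ℤ y ⊕ ker φ`, where `φ` pairs with `(f, a)`. In an
adapted basis, with matrix `W`, the functional `φ` reads off the first coordinate, so `W⁻¹` has
first row `(f, a)`. -/
lemma exists_isFlattening {d f : ℕ} {a : Fin d → ℕ} (hg : Nat.gcd f (Finset.univ.gcd a) = 1) :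
    ∃ U, IsFlattening (denumerantMatrix f a) U := by
  obtain ⟨s, t, hst⟩ := exists_bezout hg
  set φ : (Fin (d + 1) → ℤ) →ₗ[ℤ] ℤ := dotProductBilin ℤ ℤ (denumerantRow f a) with hφ
  have hφapp : ∀ x, φ x = denumerantRow f a ⬝ᵥ x := fun x => rfl
  set y : Fin (d + 1) → ℤ := Fin.cons s t with hy
  have hφy : φ y = 1 := by
    rw [hφapp, dotProduct, Fin.sum_univ_succ]
    simpa [hy, denumerantRow] using hst
  have hrank : Module.finrank ℤ (LinearMap.ker φ) = d := by
    have h1 := Submodule.finrank_quotient_add_finrank (LinearMap.ker φ)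
    rw [φ.quotKerEquivRange.finrank_eq] at h1
    have h2 : LinearMap.range φ = ⊤ := by
      rw [LinearMap.range_eq_top]
      intro c
      exact ⟨c • y, by rw [map_smul, hφy]; simp⟩
    rw [h2] at h1
    simp at h1
    omega
  set bK : Module.Basis (Fin d) ℤ (LinearMap.ker φ) :=
    (Module.finBasis ℤ (LinearMap.ker φ)).reindex (finCongr hrank)
  set B : Module.Basis (Fin (d + 1)) ℤ (Fin (d + 1) → ℤ) :=
    Module.Basis.mkFinCons y bK (by
      intro c x hx h
      have := congrArg φ h
      rw [map_add, map_smul, hφy, LinearMap.mem_ker.1 hx] at this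
      simpa using this) (by
      intro z
      refine ⟨-φ z, ?_⟩
      rw [LinearMap.mem_ker, map_add, map_smul, hφy]
      simp) with hB
  set W : Matrix (Fin (d + 1)) (Fin (d + 1)) ℤ := (Pi.basisFun ℤ (Fin (d + 1))).toMatrix B with hW
  have hWdet : IsUnit W.det := by
    rw [← Matrix.isUnit_iff_isUnit_det]
    have := (Pi.basisFun ℤ (Fin (d + 1))).toMatrix_mul_toMatrix_flip B
    exact IsUnit.of_mul_eq_one _ this
  have hrowW : Matrix.vecMul (denumerantRow f a) W = Pi.single 0 1 := by
    funext i
    have h1 : Matrix.vecMul (denumerantRow f a) W i = φ (B i) := by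
      rw [hφapp]
      simp [Matrix.vecMul, hW, Module.Basis.toMatrix_apply, dotProduct]
    rw [h1, hB, Module.Basis.coe_mkFinCons]
    refine Fin.cases ?_ (fun j => ?_) i
    · simp [hφy]
    · simp
  refine ⟨W⁻¹, isFlattening_of_row (by simpa using hWdet.ringInverse) ?_⟩
  have h2 : Matrix.vecMul (Pi.single 0 1) W⁻¹ = denumerantRow f a := by
    rw [← hrowW, Matrix.vecMul_vecMul, Matrix.mul_nonsing_inv _ hWdet, Matrix.vecMul_one]
  rw [← h2, Matrix.single_one_vecMul]
  rfl

/-! ### The index of the flattened cone -/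

/-- A unimodular transformation preserves the gcd of a column, and the entry dropped from `U * H` is
zero. -/
lemma gcd_mul_column {d : ℕ} (H : Matrix (Fin (d + 1)) (Fin d) ℤ)
    (U : Matrix (Fin (d + 1)) (Fin (d + 1)) ℤ) (hU : IsFlattening H U) (j : Fin d) :
    (Finset.univ.gcd fun i => lowerBlock H U i j) = Finset.univ.gcd fun i => H i j := by
  apply dvd_antisymm_of_normalize_eq Finset.normalize_gcd Finset.normalize_gcd
  · refine Finset.dvd_gcd fun i _ => ?_
    have hH : H = U⁻¹ * (U * H) := by
      rw [← Matrix.mul_assoc, Matrix.nonsing_inv_mul _ hU.1, Matrix.one_mul]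
    have hij : H i j = ∑ k, U⁻¹ i k * (U * H) k j := by
      conv_lhs => rw [hH, Matrix.mul_apply]
    rw [hij, Fin.sum_univ_succ, hU.2.1 j, mul_zero, zero_add]
    refine Finset.dvd_sum fun k _ => Dvd.dvd.mul_left ?_ _
    exact Finset.gcd_dvd (f := fun i => lowerBlock H U i j) (Finset.mem_univ k)
  · refine Finset.dvd_gcd fun i _ => ?_
    rw [lowerBlock, Matrix.of_apply, Matrix.mul_apply]
    refine Finset.dvd_sum fun k _ => Dvd.dvd.mul_left ?_ _
    exact Finset.gcd_dvd (f := fun i => H i j) (Finset.mem_univ k)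

lemma det_lowerBlock {d f : ℕ} {a : Fin d → ℕ} (hf : 0 < f)
    (hg : Nat.gcd f (Finset.univ.gcd a) = 1) {U : Matrix (Fin (d + 1)) (Fin (d + 1)) ℤ}
    (hU : IsFlattening (denumerantMatrix f a) U) :
    f * (lowerBlock (denumerantMatrix f a) U).det.natAbs = f ^ d := by
  -- `H` is completed by the column `e_0`: `T` is triangular with determinant `f^d`, and the first
  -- row of `U * T` is `(f, 0, …, 0)`.
  set T : Matrix (Fin (d + 1)) (Fin (d + 1)) ℤ := Matrix.of fun i =>
    Fin.cons (if i = 0 then 1 else 0) (denumerantMatrix f a i) with hT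
  have hTdet : T.det = f ^ d := by
    rw [Matrix.det_of_isUpperTriangular, Fin.prod_univ_succ]
    · simp [hT, denumerantMatrix]
    · intro i j hij
      revert hij
      refine Fin.cases ?_ (fun i => ?_) i
      · intro h; exact absurd h (by simp)
      · refine Fin.cases ?_ (fun j => ?_) j
        · intro _; simp [hT]
        · intro h
          have : i ≠ j := fun e => by simp [e] at h
          simp [hT, denumerantMatrix, this]
  have hUT : (U * T).det = f * (lowerBlock (denumerantMatrix f a) U).det := by
    have h0 : ∀ i (j : Fin d), (U * T) i j.succ = (U * denumerantMatrix f a) i j := by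
      intro i j; simp [Matrix.mul_apply, hT]
    have h1 : (U * T) 0 0 = f := by
      rw [Matrix.mul_apply, hU.first_row hf hg]; simp [hT, denumerantRow]
    rw [Matrix.det_succ_row_zero, Fin.sum_univ_succ, h1]
    simp only [h0, hU.2.1]
    simp only [Fin.val_zero, pow_zero, one_mul, mul_zero, zero_mul, Finset.sum_const_zero, add_zero]
    congr 2
  rw [Matrix.det_mul, hTdet] at hUT
  have := congrArg Int.natAbs hUT
  rw [Int.natAbs_mul, Int.natAbs_mul, Int.isUnit_iff_natAbs_eq.1 hU.1] at this
  simpa [Int.natAbs_pow] using this.symm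

lemma primitiveColumns_mul_gcd {d : ℕ} (A : Matrix (Fin d) (Fin d) ℤ) (i j : Fin d) :
    primitiveColumns A i j * (Finset.univ.gcd fun i' => A i' j) = A i j := by
  rw [primitiveColumns, Matrix.of_apply]
  exact Int.ediv_mul_cancel (Finset.gcd_dvd (f := fun i => A i j) (Finset.mem_univ i))

lemma coneIndex_mul_prod_gcd {d : ℕ} (A : Matrix (Fin d) (Fin d) ℤ) :
    coneIndex A * (∏ j, Finset.univ.gcd fun i => A i j).natAbs = A.det.natAbs := by
  have h : A = Matrix.of fun i j =>
      (fun j => Finset.univ.gcd fun i' => A i' j) j * primitiveColumns A i j := by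
    ext i j
    rw [Matrix.of_apply, mul_comm]
    exact (primitiveColumns_mul_gcd A i j).symm
  have h2 : A.det = (∏ j, Finset.univ.gcd fun i' => A i' j) * (primitiveColumns A).det := by
    conv_lhs => rw [h]
    exact Matrix.det_mul_row (fun j => Finset.univ.gcd fun i' => A i' j) (primitiveColumns A)
  rw [h2, Int.natAbs_mul, coneIndex, mul_comm]

/-- The index of the flattened cone does not depend on the flattening. -/
lemma coneIndex_lowerBlock_eq {d f : ℕ} {a : Fin d → ℕ} (hf : 0 < f)
    (hg : Nat.gcd f (Finset.univ.gcd a) = 1) {U V : Matrix (Fin (d + 1)) (Fin (d + 1)) ℤ}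
    (hU : IsFlattening (denumerantMatrix f a) U) (hV : IsFlattening (denumerantMatrix f a) V) :
    coneIndex (lowerBlock (denumerantMatrix f a) U) =
      coneIndex (lowerBlock (denumerantMatrix f a) V) := by
  have h1 := det_lowerBlock hf hg hU
  have h2 := det_lowerBlock hf hg hV
  rw [← coneIndex_mul_prod_gcd] at h1 h2
  simp only [gcd_mul_column _ _ hU] at h1
  simp only [gcd_mul_column _ _ hV] at h2
  have hpos : 0 < f ^ d := pow_pos hf d
  rw [← h2, ← mul_assoc, ← mul_assoc] at h1
  have hne : (∏ j, Finset.univ.gcd fun i => denumerantMatrix f a i j).natAbs ≠ 0 := by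
    intro h
    rw [h] at h2
    simp at h2
    exact absurd h2.symm hpos.ne'
  exact Nat.eq_of_mul_eq_mul_left hf (Nat.eq_of_mul_eq_mul_right (Nat.pos_of_ne_zero hne) h1)

lemma det_lowerBlock_ne_zero {d f : ℕ} {a : Fin d → ℕ} (hf : 0 < f)
    (hg : Nat.gcd f (Finset.univ.gcd a) = 1) {U : Matrix (Fin (d + 1)) (Fin (d + 1)) ℤ}
    (hU : IsFlattening (denumerantMatrix f a) U) :
    (lowerBlock (denumerantMatrix f a) U).det ≠ 0 := by
  intro h
  have h1 := det_lowerBlock hf hg hU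
  rw [h] at h1
  simp at h1
  exact (pow_pos hf d).ne' h1.symm

/-! ### Signed decompositions modulo periodic functions -/

/-- The indicator function of the half-space `ℓ · (z - v) ≥ 0`. -/
def halfSpaceInd {d : ℕ} (v : Fin d → ℝ) (ℓ : Fin d → ℤ) (z : Fin d → ℤ) : ℂ :=
  if 0 ≤ ∑ j, (ℓ j : ℝ) * ((z j : ℝ) - v j) then 1 else 0

/-- The indicator function of the vertex cone `{z : B (z - v) ≥ 0}`. -/
def dualConeInd {d : ℕ} (v : Fin d → ℝ) (B : Matrix (Fin d) (Fin d) ℤ) : (Fin d → ℤ) → ℂ :=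
  ∏ i, halfSpaceInd v (B i)

lemma exists_common_kernel {d : ℕ} {ι : Type*} (b : ι → Fin d → ℤ) (E : Finset ι)
    (hE : E.card < d) : ∃ m : Fin d → ℤ, m ≠ 0 ∧ ∀ i ∈ E, ∑ j, b i j * m j = 0 := by
  set M : Matrix E (Fin d) ℤ := Matrix.of fun i => b i
  by_contra! h
  have hinj : Function.Injective M.mulVecLin := by
    rw [injective_iff_map_eq_zero]
    intro m hm
    by_contra hne
    obtain ⟨i, hi, hne'⟩ := h m hne
    exact hne' (congrFun hm ⟨i, hi⟩)
  have := card_le_of_injective ℤ M.mulVecLin hinj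
  simp at this
  omega

section expansion

variable {d : ℕ} {ι : Type*} [DecidableEq ι] (v : Fin d → ℝ) (b : ι → Fin d → ℤ)

/-- The indicator function of the set where the functionals in `S` are negative and those in
`E \ S` are nonnegative. -/
def chamberInd (E S : Finset ι) : (Fin d → ℤ) → ℂ :=
  (∏ i ∈ E \ S, halfSpaceInd v (b i)) * ∏ i ∈ S, (1 - halfSpaceInd v (b i))

lemma chamberInd_empty (E : Finset ι) :
    chamberInd v b E ∅ = ∏ i ∈ E, halfSpaceInd v (b i) := by
  simp [chamberInd]

lemma chamberInd_insert {E S : Finset ι} {k : ι} (hk : k ∉ S) (hkE : k ∈ E) :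
    chamberInd v b E (insert k S) = chamberInd v b (E.erase k) S - chamberInd v b E S := by
  have h1 : E \ insert k S = (E.erase k) \ S := by
    ext i; simp; tauto
  have h2 : E \ S = insert k ((E.erase k) \ S) := by
    ext i; simp only [Finset.mem_sdiff, Finset.mem_insert, Finset.mem_erase]
    by_cases h : i = k
    · subst h; simp [hk, hkE]
    · simp [h]
  rw [chamberInd, chamberInd, chamberInd, h1, h2, Finset.prod_insert hk,
    Finset.prod_insert (by simp)]
  ring

/-- Fewer than `d` integer functionals on `ℤ^d` vanish on a common nonzero integer vector, and
translation by it preserves all the half-spaces. -/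
lemma chamberInd_mem_of_card_lt {E S : Finset ι} (hS : S ⊆ E) (hE : E.card < d) :
    chamberInd v b E S ∈ periodicSpan d := by
  obtain ⟨m, hm, h⟩ := exists_common_kernel b E hE
  apply Submodule.subset_span
  refine ⟨m, hm, fun x => ?_⟩
  have hh : ∀ i ∈ E, halfSpaceInd v (b i) (x - m) = halfSpaceInd v (b i) x := by
    intro i hi
    have h1 : ∑ j, (b i j : ℝ) * (m j : ℝ) = 0 := by exact_mod_cast h i hi
    have h2 : ∑ j, (b i j : ℝ) * (((x - m) j : ℤ) - v j) =
        ∑ j, (b i j : ℝ) * ((x j : ℝ) - v j) := by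
      rw [← sub_zero (∑ j, (b i j : ℝ) * ((x j : ℝ) - v j)), ← h1, ← Finset.sum_sub_distrib]
      refine Finset.sum_congr rfl fun j _ => ?_
      rw [Pi.sub_apply]; push_cast; ring
    unfold halfSpaceInd
    rw [h2]
  simp only [chamberInd, Pi.mul_apply, Finset.prod_apply, Pi.sub_apply, Pi.one_apply]
  congr 1
  · exact Finset.prod_congr rfl fun i hi => hh i (Finset.mem_sdiff.1 hi).1
  · exact Finset.prod_congr rfl fun i hi => by rw [hh i (hS hi)]

lemma chamberInd_sub_mem_of_card_le {E S : Finset ι} (hS : S ⊆ E) (hE : E.card ≤ d) :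
    chamberInd v b E S - (-1) ^ S.card * ∏ i ∈ E, halfSpaceInd v (b i) ∈ periodicSpan d := by
  induction S using Finset.induction_on with
  | empty => simp [chamberInd_empty]
  | insert k S hk ih =>
    have hkE : k ∈ E := hS (Finset.mem_insert_self k S)
    have hSE : S ⊆ E := (Finset.subset_insert k S).trans hS
    have h1 := chamberInd_mem_of_card_lt v b (E := E.erase k) (S := S)
      (fun i hi => Finset.mem_erase.2 ⟨fun h => hk (h ▸ hi), hSE hi⟩)
      (lt_of_lt_of_le (Finset.card_erase_lt_of_mem hkE) hE)
    convert Submodule.sub_mem _ h1 (ih hSE) using 1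
    rw [chamberInd_insert v b hk hkE, Finset.card_insert_of_notMem hk, pow_succ]
    ring

/-- Expanding the factors `1 - h_i` for `i ∈ S`, only the products that omit at most one of the `d +
1` half-spaces survive modulo periodic sums. -/
lemma chamberInd_sub_mem_of_card_le_succ {E S : Finset ι} (hS : S ⊆ E) (hE : E.card ≤ d + 1) :
    chamberInd v b E S - (-1) ^ S.card * (∏ i ∈ E, halfSpaceInd v (b i) -
      ∑ k ∈ S, ∏ i ∈ E.erase k, halfSpaceInd v (b i)) ∈ periodicSpan d := by
  induction S using Finset.induction_on with
  | empty => simp [chamberInd_empty]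
  | insert k S hk ih =>
    have hkE : k ∈ E := hS (Finset.mem_insert_self k S)
    have hSE : S ⊆ E := (Finset.subset_insert k S).trans hS
    have h1 := chamberInd_sub_mem_of_card_le v b (E := E.erase k) (S := S)
      (fun i hi => Finset.mem_erase.2 ⟨fun h => hk (h ▸ hi), hSE hi⟩)
      (by rw [Finset.card_erase_of_mem hkE]; omega)
    convert Submodule.sub_mem _ h1 (ih hSE) using 1
    rw [chamberInd_insert v b hk hkE, Finset.card_insert_of_notMem hk, pow_succ,
      Finset.sum_insert hk]
    ring

/-- In this chamber each term `e_i t_i` of the linear relation is nonnegative and at least one is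
positive, yet they sum to zero, so the chamber is empty. -/
lemma chamberInd_eq_zero {E : Finset ι} (e : ι → ℝ)
    (he : ∀ j, ∑ i ∈ E, e i * (b i j : ℝ) = 0) (hne : ∃ i ∈ E, e i < 0) :
    chamberInd v b E (E.filter fun i => e i < 0) = 0 := by
  funext z
  by_contra h
  simp only [chamberInd, Pi.mul_apply, Finset.prod_apply, Pi.sub_apply, Pi.one_apply,
    Pi.zero_apply] at h
  set t : ι → ℝ := fun i => ∑ j, (b i j : ℝ) * ((z j : ℝ) - v j) with ht
  have hpos : ∀ i ∈ E, 0 ≤ e i → 0 ≤ t i := by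
    intro i hi hei
    by_contra hlt
    refine left_ne_zero_of_mul h (Finset.prod_eq_zero (i := i) ?_ ?_)
    · simp [hi, hei]
    · exact if_neg hlt
  have hneg : ∀ i ∈ E, e i < 0 → t i < 0 := by
    intro i hi hei
    by_contra hlt
    refine right_ne_zero_of_mul h (Finset.prod_eq_zero (i := i) ?_ ?_)
    · simp [hi, hei]
    · rw [halfSpaceInd, if_pos (not_lt.1 hlt), sub_self]
  have hsum : ∑ i ∈ E, e i * t i = 0 := by
    simp only [ht, Finset.mul_sum]
    rw [Finset.sum_comm]
    refine Finset.sum_eq_zero fun j _ => ?_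
    have := he j
    simp only [← mul_assoc, ← Finset.sum_mul, this, zero_mul]
  obtain ⟨i, hi, hei⟩ := hne
  refine absurd hsum (ne_of_gt (Finset.sum_pos' (fun k hk => ?_) ⟨i, hi, ?_⟩))
  · rcases lt_or_ge (e k) 0 with h | h
    · exact (mul_pos_of_neg_of_neg h (hneg k hk h)).le
    · exact mul_nonneg h (hpos k hk h)
  · exact mul_pos_of_neg_of_neg hei (hneg i hi hei)

lemma prod_sub_sum_mem {E : Finset ι} (hE : E.card ≤ d + 1) (e : ι → ℝ)
    (he : ∀ j, ∑ i ∈ E, e i * (b i j : ℝ) = 0) (hne : ∃ i ∈ E, e i < 0) :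
    ∏ i ∈ E, halfSpaceInd v (b i) -
      ∑ k ∈ E.filter (fun i => e i < 0), ∏ i ∈ E.erase k, halfSpaceInd v (b i) ∈
      periodicSpan d := by
  have h := chamberInd_sub_mem_of_card_le_succ v b (Finset.filter_subset (fun i => e i < 0) E) hE
  rw [chamberInd_eq_zero v b e he hne, zero_sub, neg_mem_iff] at h
  rcases neg_one_pow_eq_or ((Fin d → ℤ) → ℂ) (E.filter fun i => e i < 0).card with h1 | h1
  · simpa [h1] using h
  · rw [h1, neg_one_mul, neg_mem_iff] at h
    exact h

/-- A linear relation between `d + 1` functionals on `ℤ^d` yields a relation between the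
indicator functions of the vertex cones cut out by `d` of them. -/
lemma sum_sign_mem {E : Finset ι} (hE : E.card ≤ d + 1) (e : ι → ℝ)
    (he : ∀ j, ∑ i ∈ E, e i * (b i j : ℝ) = 0) (hneg : ∃ i ∈ E, e i < 0)
    (hpos : ∃ i ∈ E, 0 < e i) :
    ∑ k ∈ E, ((SignType.sign (e k) : ℤ) : ℂ) • ∏ i ∈ E.erase k, halfSpaceInd v (b i) ∈
      periodicSpan d := by
  have h1 := prod_sub_sum_mem v b hE e he hneg
  have h2 := prod_sub_sum_mem v b hE (fun i => -e i)
    (fun j => by simp only [neg_mul, Finset.sum_neg_distrib, he j, neg_zero]) (by simpa using hpos)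
  convert Submodule.sub_mem _ h1 h2 using 1
  -- The relations for `e` and `-e` share the full product over `E`, which cancels in their
  -- difference; functionals with `e k = 0` do not contribute.
  rw [sub_sub_sub_cancel_left, Finset.sum_filter, Finset.sum_filter, ← Finset.sum_sub_distrib]
  refine Finset.sum_congr rfl fun k _ => ?_
  rcases lt_trichotomy (e k) 0 with h | h | h
  · simp [sign_neg h, h, not_lt.2 h.le]
  · simp [h]
  · simp [sign_pos h, h, not_lt.2 h.le]

end expansion

/-! ### Short vectors and unimodular decompositions -/

/-- Minkowski: some nonzero integer vector has small coordinates in the basis of rows of `B`. -/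
lemma exists_short_vector {d : ℕ} (hd : 0 < d) (B : Matrix (Fin d) (Fin d) ℤ) (hB : B.det ≠ 0) :
    ∃ (w : Fin d → ℤ) (e : Fin d → ℝ), (∀ j, (w j : ℝ) = ∑ i, e i * (B i j : ℝ)) ∧
      (∃ i, 0 < e i) ∧ ∀ i, |e i| ≤ (B.det.natAbs : ℝ) ^ (-(1 / d : ℝ)) := by
  have : Nonempty (Fin d) := ⟨⟨0, hd⟩⟩
  set D : ℝ := (B.det.natAbs : ℝ) with hD
  have hD0 : 0 < D := by
    rw [hD]; exact_mod_cast Int.natAbs_pos.2 hB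
  -- Chosen so that the image of the box `[-ρ, ρ]^d` has volume exactly `2^d`. Minkowski's bound
  -- with equality suffices because the image is compact.
  set ρ : ℝ := D ^ (-(1 / d : ℝ)) with hρ
  have hρ0 : 0 < ρ := Real.rpow_pos_of_pos hD0 _
  have hρd : D * ρ ^ d = 1 := by
    rw [hρ, ← Real.rpow_natCast, ← Real.rpow_mul hD0.le]
    have : -(1 / d : ℝ) * d = -1 := by
      have : (d : ℝ) ≠ 0 := by exact_mod_cast hd.ne'
      field_simp
    rw [this, Real.rpow_neg_one, mul_inv_cancel₀ hD0.ne']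
  set T : (Fin d → ℝ) →ₗ[ℝ] (Fin d → ℝ) :=
    Matrix.toLin' (B.map (Int.cast : ℤ → ℝ)).transpose with hT
  have hTapp : ∀ e j, T e j = ∑ i, e i * (B i j : ℝ) := by
    intro e j
    simp [hT, Matrix.toLin'_apply, Matrix.mulVec, dotProduct, mul_comm]
  have hTdet : |LinearMap.det T| = D := by
    rw [hT, LinearMap.det_toLin', Matrix.det_transpose, hD, Nat.cast_natAbs, Int.cast_abs]
    congr 1
    exact (Int.cast_det (R := ℝ) B).symm
  set box : Set (Fin d → ℝ) := Set.Icc (fun _ => -ρ) fun _ => ρ with hbox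
  set bas := Pi.basisFun ℝ (Fin d)
  have hsymm : ∀ x ∈ T '' box, -x ∈ T '' box := by
    rintro _ ⟨e, he, rfl⟩
    refine ⟨-e, ?_, map_neg T e⟩
    rw [hbox, Set.mem_Icc] at he ⊢
    exact ⟨fun i => by simpa using he.2 i, fun i => by simpa using neg_le.1 (he.1 i)⟩
  have : DiscreteTopology (Submodule.span ℤ (Set.range bas)).toAddSubgroup :=
    inferInstanceAs (DiscreteTopology (Submodule.span ℤ (Set.range bas)))
  have : Countable (Submodule.span ℤ (Set.range bas)).toAddSubgroup :=
    inferInstanceAs (Countable (Submodule.span ℤ (Set.range bas)))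
  obtain ⟨x, hx0, hxs⟩ :=
    MeasureTheory.exists_ne_zero_mem_lattice_of_measure_mul_two_pow_le_measure
      (ZSpan.isAddFundamentalDomain' bas MeasureTheory.volume) hsymm
      ((convex_Icc _ _).linear_image T)
      (isCompact_Icc.image T.continuous_of_finiteDimensional)
      (by
        rw [MeasureTheory.Measure.addHaar_image_linearMap, hTdet, hbox, Real.volume_Icc_pi]
        rw [ZSpan.fundamentalDomain_pi_basisFun, Real.volume_pi_Ico]
        simp only [sub_zero, ENNReal.ofReal_one, Finset.prod_const_one, one_mul, sub_neg_eq_add,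
          Finset.prod_const, Finset.card_univ, Fintype.card_fin, Module.finrank_fin_fun]
        rw [← ENNReal.ofReal_pow (by positivity), ← ENNReal.ofReal_mul hD0.le, ← two_mul, mul_pow,
          mul_left_comm, hρd, mul_one, ENNReal.ofReal_pow (by norm_num)]
        simp)
  obtain ⟨e, he, hex⟩ := hxs
  have hintegral : ∀ j, ∃ w : ℤ, (w : ℝ) = (x : Fin d → ℝ) j := by
    intro j
    have := (bas.mem_span_iff_repr_mem ℤ (x : Fin d → ℝ)).1 x.2 j
    simpa [bas] using this
  choose w hw using hintegral
  have hxne : (x : Fin d → ℝ) ≠ 0 := fun h => hx0 (Subtype.ext h)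
  have he0 : e ≠ 0 := by
    rintro rfl
    exact hxne (by rw [← hex, map_zero])
  have hwe : ∀ j, (w j : ℝ) = ∑ i, e i * (B i j : ℝ) := by
    intro j; rw [hw, ← hex, hTapp]
  have habs : ∀ i, |e i| ≤ ρ := fun i => abs_le.2 ⟨he.1 i, he.2 i⟩
  obtain ⟨i, hi⟩ := Function.ne_iff.1 he0
  -- The sign of `w` is free; it is chosen to make some coefficient positive, which excludes the
  -- case where all of `w`'s coefficients are nonpositive.
  rcases lt_or_gt_of_ne hi with h | h
  · refine ⟨-w, -e, fun j => ?_, ⟨i, by simpa using h⟩, by simpa using habs⟩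
    simp [hwe j]
  · exact ⟨w, e, hwe, ⟨i, h⟩, habs⟩

/-- Replacing one generator of the dual cone by `w`. -/
lemma dualConeInd_sub_sum_mem {d : ℕ} (B : Matrix (Fin d) (Fin d) ℤ) (w : Fin d → ℤ)
    (e : Fin d → ℝ) (hw : ∀ j, (w j : ℝ) = ∑ i, e i * (B i j : ℝ)) (he : ∃ i, 0 < e i)
    (v : Fin d → ℝ) :
    dualConeInd v B -
      ∑ i, ((SignType.sign (e i) : ℤ) : ℂ) • dualConeInd v (B.updateRow i w) ∈
      periodicSpan d := by
  classical
  -- The relation is `-w + ∑ e_i B_i = 0`: `none` stands for `w`, with coefficient `-1`, and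
  -- removing it gives back the original cone.
  have h := sum_sign_mem v (fun o : Option (Fin d) => o.elim w fun i => B i) (E := Finset.univ)
    (by simp) (fun o => o.elim (-1) e)
    (fun j => by rw [Fintype.sum_option]; simp [hw])
    ⟨none, Finset.mem_univ _, by simp⟩
    (by obtain ⟨i, hi⟩ := he; exact ⟨some i, Finset.mem_univ _, hi⟩)
  rw [← neg_mem_iff]
  convert h using 1
  rw [Fintype.sum_option, neg_sub, sub_eq_neg_add]
  congr 1
  · simp only [Option.elim, Left.sign_neg, sign_one]
    have : (Finset.univ.erase none : Finset (Option (Fin d))) =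
        Finset.univ.map Function.Embedding.some := by
      ext o; cases o <;> simp
    rw [this, Finset.prod_map]
    simp [dualConeInd]
  · refine Finset.sum_congr rfl fun i _ => ?_
    congr 1
    have : (Finset.univ.erase (some i) : Finset (Option (Fin d))) =
        insert none ((Finset.univ.erase i).map Function.Embedding.some) := by
      ext o; cases o <;> simp
    rw [this, Finset.prod_insert (by simp), Finset.prod_map, dualConeInd,
      ← Finset.mul_prod_erase Finset.univ _ (Finset.mem_univ i)]
    congr 1
    · simp
    · refine Finset.prod_congr rfl fun k hk => ?_
      rw [Matrix.updateRow_ne (Finset.ne_of_mem_erase hk)]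
      rfl

lemma det_updateRow_combination {d : ℕ} (B : Matrix (Fin d) (Fin d) ℤ) (w : Fin d → ℤ)
    (e : Fin d → ℝ) (hw : ∀ j, (w j : ℝ) = ∑ i, e i * (B i j : ℝ)) (i : Fin d) :
    ((B.updateRow i w).det : ℝ) = e i * (B.det : ℝ) := by
  have h : ((B.updateRow i w).map (Int.cast : ℤ → ℝ)) =
      (B.map (Int.cast : ℤ → ℝ)).updateRow i (∑ k, e k • (B.map (Int.cast : ℤ → ℝ)) k) := by
    ext r c
    by_cases hr : r = i
    · subst hr; simp [hw]
    · simp [Matrix.updateRow_ne hr]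
  have h1 := Int.cast_det (R := ℝ) (B.updateRow i w)
  have h2 := Int.cast_det (R := ℝ) B
  rw [h1, h2]
  have h3 := Matrix.det_updateRow_sum (B.map (Int.cast : ℤ → ℝ)) i e
  rw [← h] at h3
  simpa using h3

/-- With `(1 - 1/d)^p < 1/d`, the cost `M L^p` absorbs `d` children whose logarithms have shrunk by
`1 - 1/d`. The value of `M` also absorbs `d` children of cost `1`, since `L ≥ log 2`. -/
lemma exists_branching_exponent {d : ℕ} (hd : 0 < d) :
    ∃ (M : ℝ) (p : ℕ), 0 ≤ M ∧ ∀ L L' : ℝ, Real.log 2 ≤ L → 0 ≤ L' → L' ≤ (1 - 1 / d) * L →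
      d * max 1 (M * L' ^ p) ≤ M * L ^ p := by
  have hdR : (0 : ℝ) < d := by exact_mod_cast hd
  have h1d : 1 / (d : ℝ) ≤ 1 := by
    rw [div_le_one hdR]; exact_mod_cast hd
  have h1d0 : 0 < 1 / (d : ℝ) := by positivity
  obtain ⟨p, hp⟩ := exists_pow_lt_of_lt_one (x := 1 / (d : ℝ)) (y := 1 - 1 / d) h1d0 (by linarith)
  have hlog : 0 < Real.log 2 := Real.log_pos (by norm_num)
  refine ⟨d / Real.log 2 ^ p, p, by positivity, fun L L' hL hL' hLL => ?_⟩
  have hL0 : 0 ≤ L := hlog.le.trans hL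
  rw [mul_max_of_nonneg _ _ hdR.le]
  apply max_le
  · rw [mul_one, div_mul_eq_mul_div, le_div_iff₀ (by positivity)]
    gcongr
  · have h2 : L' ^ p ≤ (1 / d) * L ^ p := by
      calc L' ^ p ≤ ((1 - 1 / d) * L) ^ p := pow_le_pow_left₀ hL' hLL p
        _ = (1 - 1 / d) ^ p * L ^ p := mul_pow _ _ _
        _ ≤ _ := by gcongr
    calc (d : ℝ) * (d / Real.log 2 ^ p * L' ^ p)
        ≤ d * (d / Real.log 2 ^ p * ((1 / d) * L ^ p)) := by gcongr
      _ = _ := by field_simp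

/-- `F` is a signed sum of at most `X` indicator functions of unimodular vertex cones, for every
vertex and modulo periodic functions. -/
def HasUnimodularDecomposition {d : ℕ} (F : (Fin d → ℝ) → (Fin d → ℤ) → ℂ) (X : ℝ) : Prop :=
  ∃ (κ : Type) (_ : Fintype κ) (ε : κ → ℤ) (β : κ → Matrix (Fin d) (Fin d) ℤ),
    (∀ i, ε i = 1 ∨ ε i = -1) ∧ (∀ i, IsUnit (β i).det) ∧ (Fintype.card κ : ℝ) ≤ X ∧
    ∀ v, F v - ∑ i, (ε i : ℂ) • dualConeInd v (β i) ∈ periodicSpan d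

namespace HasUnimodularDecomposition

variable {d : ℕ} {F G : (Fin d → ℝ) → (Fin d → ℤ) → ℂ} {X Y : ℝ}

lemma mono (h : HasUnimodularDecomposition F X) (hXY : X ≤ Y) :
    HasUnimodularDecomposition F Y := by
  obtain ⟨κ, _, ε, β, h1, h2, h3, h4⟩ := h
  exact ⟨κ, _, ε, β, h1, h2, h3.trans hXY, h4⟩

lemma congr (h : HasUnimodularDecomposition F X) (hFG : ∀ v, G v - F v ∈ periodicSpan d) :
    HasUnimodularDecomposition G X := by
  obtain ⟨κ, _, ε, β, h1, h2, h3, h4⟩ := h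
  refine ⟨κ, _, ε, β, h1, h2, h3, fun v => ?_⟩
  rw [← sub_add_sub_cancel (G v) (F v)]
  exact Submodule.add_mem _ (hFG v) (h4 v)

lemma zero (hX : 0 ≤ X) : HasUnimodularDecomposition (0 : (Fin d → ℝ) → (Fin d → ℤ) → ℂ) X :=
  ⟨Empty, inferInstance, Empty.elim, Empty.elim, by simp, by simp, by simpa, by simp⟩

lemma neg (h : HasUnimodularDecomposition F X) : HasUnimodularDecomposition (-F) X := by
  obtain ⟨κ, _, ε, β, h1, h2, h3, h4⟩ := h
  refine ⟨κ, _, fun i => -ε i, β, fun i => ?_, h2, h3, fun v => ?_⟩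
  · rcases h1 i with h | h <;> simp [h]
  · rw [← neg_mem_iff]
    convert h4 v using 1
    simp only [Pi.neg_apply, Int.cast_neg, neg_smul, Finset.sum_neg_distrib]
    abel

lemma sum {F : Fin d → (Fin d → ℝ) → (Fin d → ℤ) → ℂ}
    (h : ∀ i, HasUnimodularDecomposition (F i) X) :
    HasUnimodularDecomposition (∑ i, F i) (d * X) := by
  choose κ _ ε β h1 h2 h3 h4 using h
  refine ⟨Σ i, κ i, inferInstance, fun x => ε x.1 x.2, fun x => β x.1 x.2, fun x => h1 _ _,
    fun x => h2 _ _, ?_, fun v => ?_⟩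
  · rw [Fintype.card_sigma]
    push_cast
    calc ∑ i, (Fintype.card (κ i) : ℝ) ≤ ∑ _i : Fin d, X := Finset.sum_le_sum fun i _ => h3 i
      _ = d * X := by simp
  · rw [Fintype.sum_sigma, Finset.sum_apply, ← Finset.sum_sub_distrib]
    exact Submodule.sum_mem _ fun i _ => h4 i v

end HasUnimodularDecomposition

/-- A simplicial cone is, modulo cones with lines, a short signed sum of unimodular cones. -/
lemma exists_hasUnimodularDecomposition (d : ℕ) :
    ∃ (M : ℝ) (p : ℕ), 0 ≤ M ∧ ∀ B : Matrix (Fin d) (Fin d) ℤ, B.det ≠ 0 →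
      HasUnimodularDecomposition (fun v => dualConeInd v B)
        (max 1 (M * Real.log B.det.natAbs ^ p)) := by
  have hbase : ∀ (B : Matrix (Fin d) (Fin d) ℤ) (X : ℝ), IsUnit B.det →
      HasUnimodularDecomposition (fun v => dualConeInd v B) (max 1 X) := by
    intro B X hB
    exact ⟨Unit, inferInstance, fun _ => 1, fun _ => B, fun _ => Or.inl rfl, fun _ => hB, by simp,
      fun v => by simp⟩
  rcases Nat.eq_zero_or_pos d with rfl | hd
  · exact ⟨0, 0, le_rfl, fun B _ => hbase B _ (by simp)⟩
  obtain ⟨M, p, hM, hbr⟩ := exists_branching_exponent hd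
  refine ⟨M, p, hM, ?_⟩
  intro B
  induction hn : B.det.natAbs using Nat.strong_induction_on generalizing B with
  | _ n ih =>
  intro hB
  have hn0 : 0 < n := by rw [← hn]; exact Int.natAbs_pos.2 hB
  rcases Nat.lt_or_ge 1 n with hn1 | hn1
  swap
  · exact hbase B _ (Int.isUnit_iff_natAbs_eq.2 (by omega))
  obtain ⟨w, e, hw, he, hle⟩ := exists_short_vector hd B hB
  rw [hn] at hle
  have hnR : (1 : ℝ) < n := by exact_mod_cast hn1
  have hlogn : 0 < Real.log n := Real.log_pos hnR
  have hdR : (0 : ℝ) < d := by exact_mod_cast hd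
  set c : ℝ := (1 - 1 / d) * Real.log n with hc
  have hc0 : 0 ≤ c := by
    have : 1 / (d : ℝ) ≤ 1 := by rw [div_le_one hdR]; exact_mod_cast hd
    exact mul_nonneg (by linarith) hlogn.le
  have hchild : ∀ i, HasUnimodularDecomposition
      (fun v => ((SignType.sign (e i) : ℤ) : ℂ) • dualConeInd v (B.updateRow i w))
      (max 1 (M * c ^ p)) := by
    intro i
    by_cases hei : e i = 0
    · convert HasUnimodularDecomposition.zero (d := d) (X := max 1 (M * c ^ p)) (by positivity)
        using 1
      funext v
      simp [hei]
    have hdet := det_updateRow_combination B w e hw i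
    have hdetne : (B.updateRow i w).det ≠ 0 := by
      intro h
      rw [h] at hdet
      have : (B.det : ℝ) ≠ 0 := by exact_mod_cast hB
      exact mul_ne_zero hei this (by simpa using hdet.symm)
    have hdetabs : ((B.updateRow i w).det.natAbs : ℝ) = |e i| * n := by
      rw [Nat.cast_natAbs, Int.cast_abs, hdet, abs_mul, ← hn, Nat.cast_natAbs, Int.cast_abs]
    have hei0 : 0 < |e i| := abs_pos.2 hei
    -- For `n > 1` the Minkowski bound `n^(-1/d)` is below `1`, so the determinant strictly drops
    -- and the induction applies.
    have hlt1 : |e i| < 1 :=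
      (hle i).trans_lt (Real.rpow_lt_one_of_one_lt_of_neg hnR (by simpa using hd))
    have hlt : (B.updateRow i w).det.natAbs < n := by
      have : ((B.updateRow i w).det.natAbs : ℝ) < n := by
        rw [hdetabs]
        exact mul_lt_of_lt_one_left (by linarith) hlt1
      exact_mod_cast this
    have hdec := ih _ hlt (B.updateRow i w) rfl hdetne
    have hlogle : Real.log (B.updateRow i w).det.natAbs ≤ c := by
      rw [hdetabs, Real.log_mul hei0.ne' (by linarith)]
      have := Real.log_le_log hei0 (hle i)
      rw [Real.log_rpow (by linarith)] at this
      rw [hc]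
      linarith
    have hlog0 : 0 ≤ Real.log (B.updateRow i w).det.natAbs := Real.log_natCast_nonneg _
    have hdec' := hdec.mono (Y := max 1 (M * c ^ p)) (by gcongr)
    rcases lt_or_gt_of_ne hei with h | h
    · convert hdec'.neg using 1
      funext v
      simp [sign_neg h]
    · convert hdec' using 1
      funext v
      simp [sign_pos h]
  have hlog2 : Real.log 2 ≤ Real.log n :=
    Real.log_le_log (by norm_num) (by exact_mod_cast hn1)
  refine ((HasUnimodularDecomposition.sum hchild).mono
    ((hbr _ _ hlog2 hc0 le_rfl).trans (le_max_right _ _))).congr fun v => ?_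
  rw [Finset.sum_apply]
  exact dualConeInd_sub_sum_mem B w e hw he v

/-! ### Transfer to the flattened lattice -/

/-- `B` describes, in the coordinates given by the unimodular matrix `U`, the cone generated by the
columns of `A` as a dual cone; the columns of `A` lie in the kernel of the first row of `U`. -/
structure IsDualDescription {d : ℕ} (U : Matrix (Fin (d + 1)) (Fin (d + 1)) ℤ)
    (A : Matrix (Fin (d + 1)) (Fin d) ℤ) (B : Matrix (Fin d) (Fin d) ℤ) (c : Fin d → ℤ) :
    Prop where
  isUnit_det : IsUnit U.det
  row_zero : ∀ j, (U * A) 0 j = 0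
  mul_lowerBlock : B * lowerBlock A U = Matrix.diagonal c
  pos : ∀ j, 0 < c j

namespace IsDualDescription

variable {d : ℕ} {U : Matrix (Fin (d + 1)) (Fin (d + 1)) ℤ} {A : Matrix (Fin (d + 1)) (Fin d) ℤ}
  {B : Matrix (Fin d) (Fin d) ℤ} {c : Fin d → ℤ}

/-- Over a field of characteristic zero both `U` and `B` are invertible, so applying them loses
nothing and diagonalizes the system `y = A k`. The field is arbitrary because cones need `ℝ` and the
coefficients `k_ij` need `ℚ`. -/
lemma combination_iff (h : IsDualDescription U A B c) {K : Type*} [Field K] [CharZero K]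
    (y : Fin (d + 1) → K) (k : Fin d → K) :
    (∀ r, y r = ∑ j, k j * (A r j : K)) ↔
      (∑ i, (U 0 i : K) * y i = 0) ∧
        ∀ r, ∑ i, (B r i : K) * ∑ s, (U i.succ s : K) * y s = c r * k r := by
  set ψ : ℤ →+* K := Int.castRingHom K
  set UK := U.map ψ with hUK
  set AK := A.map ψ with hAK
  set BK := B.map ψ with hBK
  have hUdet : IsUnit UK.det := by
    have : UK.det = ψ U.det := (RingHom.map_det ψ U).symm
    rw [this]; exact h.isUnit_det.map ψ
  have hUA : UK * AK = (U * A).map ψ := (Matrix.map_mul).symm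
  have hUinj : Function.Injective UK.mulVec :=
    Matrix.mulVec_injective_of_isUnit ((Matrix.isUnit_iff_isUnit_det _).2 hUdet)
  have hBA : BK * (lowerBlock A U).map ψ = Matrix.diagonal fun j => (c j : K) := by
    rw [hBK, ← Matrix.map_mul, h.mul_lowerBlock, Matrix.diagonal_map (map_zero ψ)]
    rfl
  have hBdet : IsUnit BK.det := by
    have h1 := congrArg Matrix.det hBA
    rw [Matrix.det_mul, Matrix.det_diagonal] at h1
    refine isUnit_iff_ne_zero.2 (left_ne_zero_of_mul (h1.trans_ne ?_))
    exact Finset.prod_ne_zero_iff.2 fun j _ => by exact_mod_cast (h.pos j).ne'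
  have hBinj : Function.Injective BK.mulVec :=
    Matrix.mulVec_injective_of_isUnit ((Matrix.isUnit_iff_isUnit_det _).2 hBdet)
  have e1 : (∀ r, y r = ∑ j, k j * (A r j : K)) ↔ y = AK.mulVec k := by
    rw [funext_iff]
    refine forall_congr' fun r => ?_
    simp only [Matrix.mulVec, dotProduct, mul_comm (k _)]
    rfl
  have e2 : (AK.mulVec k = y) ↔ UK.mulVec (AK.mulVec k) = UK.mulVec y := hUinj.eq_iff.symm
  have e3 : UK.mulVec (AK.mulVec k) 0 = 0 := by
    rw [Matrix.mulVec_mulVec, hUA]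
    simp [Matrix.mulVec, dotProduct, h.row_zero]
  have e4 : (fun i : Fin d => UK.mulVec (AK.mulVec k) i.succ) =
      ((lowerBlock A U).map ψ).mulVec k := by
    rw [Matrix.mulVec_mulVec, hUA]; rfl
  have e5 : BK.mulVec (((lowerBlock A U).map ψ).mulVec k) = fun r => (c r : K) * k r := by
    rw [Matrix.mulVec_mulVec, hBA]
    funext r
    rw [Matrix.mulVec_diagonal]
  rw [e1, eq_comm, e2]
  have e6 : UK.mulVec (AK.mulVec k) = UK.mulVec y ↔ UK.mulVec y 0 = 0 ∧
      (fun i : Fin d => UK.mulVec y i.succ) = ((lowerBlock A U).map ψ).mulVec k := by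
    rw [← e4, funext_iff, Fin.forall_fin_succ, e3, funext_iff]
    exact and_congr eq_comm (forall_congr' fun i => eq_comm)
  rw [e6, ← hBinj.eq_iff, e5, funext_iff]
  rfl

lemma mem_vertexCone_iff (h : IsDualDescription U A B c) (v : Fin (d + 1) → ℚ)
    (x : Fin (d + 1) → ℝ) :
    x ∈ vertexCone v A ↔ (∑ i, (U 0 i : ℝ) * (x i - v i) = 0) ∧
      ∀ r, 0 ≤ ∑ i, (B r i : ℝ) * ∑ s, (U i.succ s : ℝ) * (x s - v s) := by
  constructor
  · rintro ⟨k, hk, hx⟩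
    have := (h.combination_iff (fun r => x r - v r) k).1 fun r => by
      rw [hx r]; ring
    refine ⟨this.1, fun r => ?_⟩
    rw [this.2 r]
    exact mul_nonneg (by exact_mod_cast (h.pos r).le) (hk r)
  · rintro ⟨h1, h2⟩
    have hc : ∀ r, (0 : ℝ) < c r := fun r => by exact_mod_cast h.pos r
    refine ⟨fun r => (∑ i, (B r i : ℝ) * ∑ s, (U i.succ s : ℝ) * (x s - v s)) / c r,
      fun r => div_nonneg (h2 r) (hc r).le, ?_⟩
    have := (h.combination_iff (fun r => x r - v r)
      (fun r => (∑ i, (B r i : ℝ) * ∑ s, (U i.succ s : ℝ) * (x s - v s)) / c r)).2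
      ⟨h1, fun r => (mul_div_cancel₀ _ (hc r).ne').symm⟩
    intro r
    have h3 := this r
    beta_reduce at h3
    linarith

lemma exists_combination (h : IsDualDescription U A B c) {K : Type*} [Field K] [CharZero K]
    (y : Fin (d + 1) → K) (hy : ∑ i, (U 0 i : K) * y i = 0) :
    ∃ k : Fin d → K, ∀ r, y r = ∑ j, k j * (A r j : K) :=
  ⟨fun r => (∑ i, (B r i : K) * ∑ s, (U i.succ s : K) * y s) / c r,
    (h.combination_iff y _).2 ⟨hy, fun r =>
      (mul_div_cancel₀ _ (by exact_mod_cast (h.pos r).ne')).symm⟩⟩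

/-- When `c = 1` the coordinates of an integer point are integer combinations of its entries, given
by `B` and the lower rows of `U`. -/
lemma generatesUnimodularCone (h : IsDualDescription U A B c) (hc : c = 1) :
    GeneratesUnimodularCone A := by
  subst hc
  constructor
  · rw [Fintype.linearIndependent_iff]
    intro g hg j
    have h0 := ((h.combination_iff (K := ℝ) 0 g).1 fun r => by
      have := congrFun hg r
      simpa using this.symm).2 j
    simpa using h0.symm
  · intro x hx
    obtain ⟨k, hk⟩ := (Submodule.mem_span_range_iff_exists_fun ℝ).1 hx
    have hk' : ∀ r, (x r : ℝ) = ∑ j, k j * (A r j : ℝ) := by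
      intro r
      have := congrFun hk r
      simpa using this.symm
    have h1 := ((h.combination_iff (fun r => (x r : ℝ)) k).1 hk').2
    rw [Submodule.mem_span_range_iff_exists_fun]
    refine ⟨fun r => ∑ i, B r i * ∑ s, U i.succ s * x s, ?_⟩
    funext r
    have h2 : ∀ j, k j = ((∑ i, B j i * ∑ s, U i.succ s * x s : ℤ) : ℝ) := by
      intro j
      have := h1 j
      push_cast
      rw [this]
      simp
    have h3 := hk' r
    simp only [h2] at h3
    simp only [Finset.sum_apply, Pi.smul_apply, smul_eq_mul]
    exact_mod_cast h3.symm

end IsDualDescription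

/-- The formal sum on `ℤ^(d+1)` that is supported on the slice through `v` where the first
coordinate of `U x` is constant, with coefficients `F` in the remaining coordinates. -/
def sliceLift {d : ℕ} (U : Matrix (Fin (d + 1)) (Fin (d + 1)) ℤ) (v : Fin (d + 1) → ℚ) :
    ((Fin d → ℤ) → ℂ) →ₗ[ℂ] ((Fin (d + 1) → ℤ) → ℂ) where
  toFun F x := (if ∑ i, (U 0 i : ℝ) * ((x i : ℝ) - v i) = 0 then 1 else 0) *
    F fun i => ∑ s, U i.succ s * x s
  map_add' F G := by funext x; simp [mul_add]
  map_smul' c F := by funext x; simp [mul_left_comm]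

lemma sliceLift_apply {d : ℕ} (U : Matrix (Fin (d + 1)) (Fin (d + 1)) ℤ) (v : Fin (d + 1) → ℚ)
    (F : (Fin d → ℤ) → ℂ) (x : Fin (d + 1) → ℤ) :
    sliceLift U v F x = (if ∑ i, (U 0 i : ℝ) * ((x i : ℝ) - v i) = 0 then 1 else 0) *
      F fun i => ∑ s, U i.succ s * x s := rfl

/-- A period `m` in `ℤ^d` lifts to `U⁻¹ (0, m)`, which is nonzero and preserves the slice. -/
lemma sliceLift_mem_periodicSpan {d : ℕ} {U : Matrix (Fin (d + 1)) (Fin (d + 1)) ℤ}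
    (hU : IsUnit U.det) (v : Fin (d + 1) → ℚ) {F : (Fin d → ℤ) → ℂ} (hF : F ∈ periodicSpan d) :
    sliceLift U v F ∈ periodicSpan (d + 1) := by
  have hle : periodicSpan d ≤ (periodicSpan (d + 1)).comap (sliceLift U v) := by
    refine Submodule.span_le.2 ?_
    rintro G ⟨m, hm, hG⟩
    refine Submodule.subset_span ⟨U⁻¹.mulVec (Fin.cons 0 m), ?_, fun x => ?_⟩
    · intro h
      have h1 := congrArg U.mulVec h
      rw [Matrix.mulVec_mulVec, Matrix.mul_nonsing_inv _ hU, Matrix.one_mulVec,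
        Matrix.mulVec_zero] at h1
      exact hm (funext fun i => by simpa using congrFun h1 i.succ)
    · set μ := U⁻¹.mulVec (Fin.cons 0 m : Fin (d + 1) → ℤ) with hμ
      have hUμ : U.mulVec μ = Fin.cons 0 m := by
        rw [hμ, Matrix.mulVec_mulVec, Matrix.mul_nonsing_inv _ hU, Matrix.one_mulVec]
      have h0 : ∑ i, U 0 i * μ i = 0 := congrFun hUμ 0
      have hs : ∀ j : Fin d, ∑ i, U j.succ i * μ i = m j := fun j => congrFun hUμ j.succ
      have h0R : ∑ i, (U 0 i : ℝ) * (μ i : ℝ) = 0 := by exact_mod_cast h0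
      have e1 : ∑ i, (U 0 i : ℝ) * ((((x - μ) i : ℤ) : ℝ) - v i) =
          ∑ i, (U 0 i : ℝ) * ((x i : ℝ) - v i) := by
        rw [← sub_zero (∑ i, (U 0 i : ℝ) * ((x i : ℝ) - v i)), ← h0R, ← Finset.sum_sub_distrib]
        refine Finset.sum_congr rfl fun i _ => ?_
        rw [Pi.sub_apply]; push_cast; ring
      have e2 : (fun i : Fin d => ∑ s, U i.succ s * (x - μ) s) =
          (fun i : Fin d => ∑ s, U i.succ s * x s) - m := by
        funext i
        simp [mul_sub, Finset.sum_sub_distrib, hs]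
      rw [sliceLift_apply, sliceLift_apply, e1, e2, hG]
  exact hle hF

lemma IsDualDescription.latticeIndicator_eq {d : ℕ} {U : Matrix (Fin (d + 1)) (Fin (d + 1)) ℤ}
    {A : Matrix (Fin (d + 1)) (Fin d) ℤ} {B : Matrix (Fin d) (Fin d) ℤ} {c : Fin d → ℤ}
    (h : IsDualDescription U A B c) (v : Fin (d + 1) → ℚ) :
    latticeIndicator (vertexCone v A) =
      sliceLift U v (dualConeInd (fun i => ∑ s, (U i.succ s : ℝ) * v s) B) := by
  classical
  funext x
  have hz : ∀ i : Fin d, ∑ s, (U i.succ s : ℝ) * ((x s : ℝ) - v s) =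
      ((∑ s, U i.succ s * x s : ℤ) : ℝ) - ∑ s, (U i.succ s : ℝ) * v s := by
    intro i
    push_cast
    rw [← Finset.sum_sub_distrib]
    exact Finset.sum_congr rfl fun s _ => by ring
  simp only [latticeIndicator, Set.indicator, h.mem_vertexCone_iff, Pi.one_apply, hz]
  rw [sliceLift_apply]
  simp only [dualConeInd, Finset.prod_apply, halfSpaceInd]
  rw [Finset.prod_ite_zero]
  simp only [Finset.prod_const_one, Finset.mem_univ, true_imp_iff]
  split_ifs <;> first | (exfalso; tauto) | simp

/-- The matrix with zero first row after flattening and remaining block `β⁻¹`. -/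
def unflatten {d : ℕ} (U : Matrix (Fin (d + 1)) (Fin (d + 1)) ℤ) (β : Matrix (Fin d) (Fin d) ℤ) :
    Matrix (Fin (d + 1)) (Fin d) ℤ :=
  U⁻¹ * Matrix.of (Fin.cons 0 fun i => β⁻¹ i)

lemma isDualDescription_unflatten {d : ℕ} {U : Matrix (Fin (d + 1)) (Fin (d + 1)) ℤ}
    (hU : IsUnit U.det) {β : Matrix (Fin d) (Fin d) ℤ} (hβ : IsUnit β.det) :
    IsDualDescription U (unflatten U β) β 1 := by
  have h : U * unflatten U β = Matrix.of (Fin.cons 0 fun i => β⁻¹ i) := by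
    rw [unflatten, ← Matrix.mul_assoc, Matrix.mul_nonsing_inv _ hU, Matrix.one_mul]
  refine ⟨hU, fun j => by rw [h]; simp, ?_, by simp⟩
  have h2 : lowerBlock (unflatten U β) U = β⁻¹ := by
    ext i j
    simp [lowerBlock, h]
  rw [h2, Matrix.mul_nonsing_inv _ hβ]
  exact Matrix.diagonal_one.symm

/-- The cone `C(H)` has a dual description by a matrix whose determinant is a power of the index
of the flattened cone. -/
lemma exists_isDualDescription {d : ℕ} {H : Matrix (Fin (d + 1)) (Fin d) ℤ}
    {U : Matrix (Fin (d + 1)) (Fin (d + 1)) ℤ} (hU : IsFlattening H U)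
    (hdet : (lowerBlock H U).det ≠ 0) :
    ∃ (B : Matrix (Fin d) (Fin d) ℤ) (c : Fin d → ℤ), IsDualDescription U H B c ∧ B.det ≠ 0 ∧
      B.det.natAbs = coneIndex (lowerBlock H U) ^ (d - 1) := by
  set P := primitiveColumns (lowerBlock H U) with hP
  set g : Fin d → ℤ := fun j => Finset.univ.gcd fun i => lowerBlock H U i j with hg
  have hfac := coneIndex_mul_prod_gcd (lowerBlock H U)
  have hPdet : P.det ≠ 0 := by
    intro h
    rw [coneIndex, ← hP, h] at hfac
    exact hdet (Int.natAbs_eq_zero.1 (by simpa using hfac.symm))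
  have hg0 : ∀ j, 0 < g j := by
    intro j
    refine lt_of_le_of_ne (Int.nonneg_of_normalize_eq_self Finset.normalize_gcd) fun h => hdet ?_
    refine Matrix.det_eq_zero_of_column_eq_zero j fun i => ?_
    exact Finset.gcd_eq_zero_iff.1 h.symm i (Finset.mem_univ i)
  have hPg : lowerBlock H U = P * Matrix.diagonal g := by
    ext i j
    rw [Matrix.mul_diagonal]
    exact (primitiveColumns_mul_gcd (lowerBlock H U) i j).symm
  have hsgn : (P.det.sign).natAbs = 1 := Int.natAbs_sign_of_ne_zero hPdet
  have hBdet : (P.det.sign • P.adjugate).det.natAbs = coneIndex (lowerBlock H U) ^ (d - 1) := by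
    rw [Matrix.det_smul, Matrix.det_adjugate, Int.natAbs_mul, Int.natAbs_pow, Int.natAbs_pow, hsgn,
      one_pow, one_mul, Fintype.card_fin]
    rfl
  -- The facet normals come from the adjugate of the primitive generators `P`; the sign makes the
  -- diagonal entries `|det P| g_j` positive. Its determinant brings in the exponent `d - 1`.
  refine ⟨P.det.sign • P.adjugate, fun j => |P.det| * g j, ⟨hU.1, hU.2.1, ?_, fun j => ?_⟩, ?_,
    hBdet⟩
  · rw [hPg, ← Matrix.mul_assoc, Matrix.smul_mul, Matrix.adjugate_mul, smul_smul,
      Int.sign_mul_self_eq_abs, Matrix.smul_mul, Matrix.one_mul]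
    ext i j
    by_cases h : i = j
    · subst h; simp
    · simp [h]
  · exact mul_pos (abs_pos.2 hPdet) (hg0 j)
  · rw [← Int.natAbs_ne_zero, hBdet]
    exact pow_ne_zero _ (Int.natAbs_ne_zero.2 hPdet)

lemma sum_row_mul_denumerantVertex {d f : ℕ} {a : Fin d → ℕ} (hf : 0 < f)
    (hg : Nat.gcd f (Finset.univ.gcd a) = 1) {U : Matrix (Fin (d + 1)) (Fin (d + 1)) ℤ}
    (hU : IsFlattening (denumerantMatrix f a) U) (b : ℤ) :
    ∑ i, (U 0 i : ℚ) * denumerantVertex d f b i = b := by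
  have : (f : ℚ) ≠ 0 := by exact_mod_cast hf.ne'
  rw [hU.first_row hf hg]
  simp [denumerantVertex, denumerantRow, Pi.single_apply]
  field_simp

end

theorem mainTheorem2 (d : ℕ) :
    -- the bound for the number of summands depends on the dimension only
    ∃ bd : Polynomial ℝ,
    ∀ (f : ℕ) (a : Fin d → ℕ), 0 < f → (∀ j, 0 < a j) → Nat.gcd f (Finset.univ.gcd a) = 1 →
    -- signs and unimodular cones, independent of `b`
    ∃ (N : ℕ) (ε : Fin N → ℤ) (α : Fin N → Matrix (Fin (d + 1)) (Fin d) ℤ),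
      (∀ i, ε i = 1 ∨ ε i = -1) ∧
      (∀ i, GeneratesUnimodularCone (α i)) ∧
      -- the unimodular transformations `U`, their first row, and the sum being short
      (∃ U, IsFlattening (denumerantMatrix f a) U) ∧
      (∀ U, IsFlattening (denumerantMatrix f a) U →
        U 0 0 = (f : ℤ) ∧ (∀ j : Fin d, U 0 j.succ = (a j : ℤ)) ∧
        (N : ℝ) ≤ bd.eval (Real.log (coneIndex (lowerBlock (denumerantMatrix f a) U)))) ∧
      ∀ b : ℤ,
        -- every `U` provides a decomposition `v = γ + ∑ k_{ij} α_{ij}` with `γ = U⁻¹ (b, 0, …, 0)`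
        (∀ U, IsFlattening (denumerantMatrix f a) U → ∀ i, ∃ k : Fin d → ℚ, ∀ r,
          denumerantVertex d f b r =
            ((U⁻¹.mulVec (Pi.single 0 b) r : ℤ) : ℚ) + ∑ j, k j * (α i r j : ℚ)) ∧
        -- the constant term is well defined
        ∃ ct : YField (d + 1), (∀ c, IsDenumerantCT f a b c ↔ c = ct) ∧
          -- it is the generating function of `v + C(H)`
          IsLatticeGenFun (vertexCone (denumerantVertex d f b) (denumerantMatrix f a)) ct ∧
          -- and the signed sum over the unimodular cones
          ∀ (γ : Fin N → Fin (d + 1) → ℤ) (k : Fin N → Fin d → ℚ),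
            (∀ i r, denumerantVertex d f b r = (γ i r : ℚ) + ∑ j, k i j * (α i r j : ℚ)) →
            ct = ∑ i, (ε i : YField (d + 1)) * coneTerm (ceilExponent (γ i) (k i) (α i)) (α i) ∧
            ∀ i, IsLatticeGenFun (vertexCone (denumerantVertex d f b) (α i))
              (coneTerm (ceilExponent (γ i) (k i) (α i)) (α i)) := by
  obtain ⟨M, p, hM, hdec⟩ := exists_hasUnimodularDecomposition d
  -- Since `|det B| = ind^(d-1)`, the logarithm is `(d - 1) log ind`; the summand `1` accounts for
  -- the maximum with `1` in the count.
  refine ⟨1 + Polynomial.C M * (Polynomial.C ((d - 1 : ℕ) : ℝ) * Polynomial.X) ^ p, ?_⟩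
  intro f a hf ha hg
  obtain ⟨U, hU⟩ := exists_isFlattening hg
  obtain ⟨B, c, hB, hBdet, hBabs⟩ := exists_isDualDescription hU (det_lowerBlock_ne_zero hf hg hU)
  obtain ⟨κ, _, ε, β, hε, hβ, hcard, hmem⟩ := hdec B hBdet
  set E := (Fintype.equivFin κ).symm with hE
  have hα : ∀ i, IsDualDescription U (unflatten U (β (E i))) (β (E i)) 1 := fun i =>
    isDualDescription_unflatten hU.1 (hβ (E i))
  have hα' : ∀ i, GeneratesUnimodularCone (unflatten U (β (E i))) := fun i =>
    (hα i).generatesUnimodularCone rfl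
  refine ⟨Fintype.card κ, fun i => ε (E i), fun i => unflatten U (β (E i)), fun i => hε _, hα',
    ⟨U, hU⟩, ?_, fun b => ⟨?_, denumerantCT f a b, isDenumerantCT_iff hf ha,
      isLatticeGenFun_denumerantCT hf a b, fun γ k hv => ?_⟩⟩
  · intro V hV
    have hrow := hV.first_row hf hg
    refine ⟨by rw [hrow]; rfl, fun j => by rw [hrow]; rfl, hcard.trans ?_⟩
    rw [coneIndex_lowerBlock_eq hf hg hV hU, hBabs, Nat.cast_pow, Real.log_pow]
    have hL : 0 ≤ Real.log (coneIndex (lowerBlock (denumerantMatrix f a) U)) :=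
      Real.log_natCast_nonneg _
    simp only [Polynomial.eval_add, Polynomial.eval_one, Polynomial.eval_mul, Polynomial.eval_C,
      Polynomial.eval_pow, Polynomial.eval_X]
    have h0 : 0 ≤ M * (((d - 1 : ℕ) : ℝ) *
      Real.log (coneIndex (lowerBlock (denumerantMatrix f a) U))) ^ p := by positivity
    exact max_le (by linarith) (by linarith)
  · intro V hV i
    obtain ⟨k, hk⟩ := (hα i).exists_combination
      (fun r => denumerantVertex d f b r - ((V⁻¹.mulVec (Pi.single 0 b) r : ℤ) : ℚ)) (by
        have h1 : ∑ r, V 0 r * V⁻¹.mulVec (Pi.single 0 b) r = b := by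
          have : V.mulVec (V⁻¹.mulVec (Pi.single 0 b)) = Pi.single 0 b := by
            rw [Matrix.mulVec_mulVec, Matrix.mul_nonsing_inv _ hV.1, Matrix.one_mulVec]
          exact (congrFun this 0).trans (Pi.single_eq_same _ _)
        -- All flattenings share their first row, so the slice condition for the fixed `U` can be
        -- checked with `V`.
        rw [← (hV.first_row hf hg).trans (hU.first_row hf hg).symm] at *
        simp only [mul_sub, Finset.sum_sub_distrib]
        rw [sum_row_mul_denumerantVertex hf hg hV b, sub_eq_zero]
        exact_mod_cast h1.symm)
    exact ⟨k, fun r => by rw [← hk r]; ring⟩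
  · have hgen : ∀ i, IsLatticeGenFun (vertexCone (denumerantVertex d f b) (unflatten U (β (E i))))
        (coneTerm (ceilExponent (γ i) (k i) (unflatten U (β (E i)))) (unflatten U (β (E i)))) :=
      fun i => isLatticeGenFun_unimodular (hα' i) (hv i)
    refine ⟨?_, hgen⟩
    have hsum : IsFormalGenFun
        (∑ i, (ε (E i) : ℂ) •
          latticeIndicator (vertexCone (denumerantVertex d f b) (unflatten U (β (E i)))))
        (∑ i, (ε (E i) : YField (d + 1)) *
          coneTerm (ceilExponent (γ i) (k i) (unflatten U (β (E i)))) (unflatten U (β (E i)))) :=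
      IsFormalGenFun.sum _ fun i _ => by
        simpa using (isLatticeGenFun_iff.1 (hgen i)).smul (ε (E i) : ℂ)
    have hdiff : latticeIndicator (vertexCone (denumerantVertex d f b) (denumerantMatrix f a)) -
        ∑ i, (ε (E i) : ℂ) •
          latticeIndicator (vertexCone (denumerantVertex d f b) (unflatten U (β (E i)))) ∈
        periodicSpan (d + 1) := by
      -- The decomposition in `ℤ^d`, taken at the image of `v` under the lower rows of `U`, is
      -- lifted to the slice through `v`.
      convert sliceLift_mem_periodicSpan hU.1 (denumerantVertex d f b)
        (hmem fun i => ∑ s, (U i.succ s : ℝ) * denumerantVertex d f b s) using 1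
      rw [map_sub, map_sum, hB.latticeIndicator_eq, ← E.sum_comp]
      congr 1
      refine Finset.sum_congr rfl fun i _ => ?_
      rw [map_smul, (hα i).latticeIndicator_eq]
    have h := (IsFormalGenFun.of_mem_periodicSpan hdiff).add hsum
    rw [sub_add_cancel, zero_add] at h
    exact (isLatticeGenFun_iff.1 (isLatticeGenFun_denumerantCT hf a b)).unique h
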